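/- **Setting.** Fix integers $n,M\ge 1$ and $N_{Top}\ge n+5$, and set $N_{Mid}:=\lceil N_{Top}/2\rceil+1$. On $\mathbb R\times\mathbb R\times\mathbb T^{n-1}$, with Cartesian coordinates $(t=x^0,x^1,\dots,x^n)$, consider the system $$L^\alpha(\Psi,v)\,\partial_\alpha\Psi=0,\qquad A^\alpha(\Psi,v)\,\partial_\alpha v=0,\qquad v=(v^1,\dots,v^M),$$ with $L^\alpha$ and the symmetric $M\times M$ matrices $A^\alpha$ smooth functions of $(\Psi,v)$, such that $L^0\equiv1$, $L^1|_{(0,0)}=1$, $\partial L^1/\partial\Psi\ne0$ for small $(\Psi,v)$, and $A^0|_{(0,0)}$ and $A^0|_{(0,0)}-A^1|_{(0,0)}$ are positive definite. Write $L=L^\alpha\partial_\alpha$ and $V^J_\alpha:=\partial_\alpha v^J$. The eikonal function $u$ solves $Lu=0$, $u|_{t=0}=1-x^1$, and $\vartheta=(\vartheta^2,\dots,\vartheta^n)$ solves $L\vartheta^i=0$, $\vartheta^i|_{t=0}=x^i$. The map $\Upsilon$ sends the geometric coordinates $(t,u,\vartheta)$ to the Cartesian ones, $\Sigma_t^{u}$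 is the set of points with time $t$ and eikonal value in $[0,u]$, and $\mathcal M_{T,U}$ is the set of points with $0\le t<T$ and eikonal value in $[0,U]$. Let $$\upmu:=\frac1{\partial_tu},\quad \upxi_j:=\upmu\,\partial_ju,\quad X:=-\sum_{j=1}^nL^j\partial_j,\quad \breve X:=\upmu X,\quad \mathcal G:=\frac{\partial L^1}{\partial\Psi}\,\upxi_1,\quad \Theta_i:=\frac{\partial}{\partial\vartheta^i},$$ $\upxi_j^{(Small)}:=\upxi_j+\delta_j^1$ and $\Theta_i^{j,(Small)}:=\Theta_i x^j-\delta^{ij}$. Along $\Sigma_0$ one has $\mathcal G=-(\partial L^1/\partial\Psi)/L^1$, a function of $(\Psi,v)$; $\widetilde{\mathcal G}$ denotes its value at $(0,0)$. Let $\mathring A_*:=\sup_{\Sigma_0^1}|\min\{\mathcal G\breve X\Psi,0\}|$ and $\upmu_\star(t,u):=\min_{\Sigma_t^u}\upmu$. *Strings.* $\mathscr P^N$ denotes strings of $N$ factors from $\{L,\Theta_2,\dots,\Theta_n\}$; $\mathscr P_*^N$ those with at least one factor $\Theta_i$ or at least two factors $L$; $\mathscr Z^{N;1}$ strings of $N$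 factors from $\{L,\breve X,\Theta_2,\dots,\Theta_n\}$ with at most one $\breve X$; $\mathscr Z_*^{N;1}$ those that moreover have at least one factor different from $\breve X$. A superscript $\le N$ or $[1,N]$ means that the absolute values are summed over all such strings of length in $[0,N]$, respectively $[1,N]$ (and over all components, for arrays). *Solution.* Let $0<U_0\le1$ and $T_{(Boot)},\tau>0$. Let $(\Psi,v)$ be a smooth solution (up to the boundary) on $\mathcal M_{T_{(Boot)},U_0}\cup\mathcal M_{\tau,1}$, where $\Upsilon$ is a diffeomorphism from the corresponding region of geometric coordinates onto its image (the thin slab $\mathcal M_{\tau,1}$ only serves to give meaning to derivatives along $\Sigma_0^1$). Let $\mathring A>0$, $\mathring A_*>0$ and $T_{(Boot)}\le2\mathring A_*^{-1}$. *Data.* On $\Sigma_0^1$: $\|\Psi\|_{L^\infty}\le\mathring\upalpha$; $\|\breve X\Psi\|_{L^\infty}\le\mathring A$; and $\|\mathscr Z_*^{[1,N_{Mid}];1}\Psi\|_{L^\infty}$, $\|\mathscr Z^{\le N_{Mid}-1;1}v\|_{L^\infty}$, $\|\mathscr Z^{\le N_{Mid}-1;1}V\|_{L^\infty}\le\mathring\upepsilon$.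 *Bootstrap assumptions.* $\upmu>0$ on $\mathcal M_{T_{(Boot)},U_0}$, and for all $(t,u)\in[0,T_{(Boot)})\times[0,U_0]$, in the norm $\|\cdot\|=\|\cdot\|_{L^\infty(\Sigma_t^u)}$ and for all indices: $\|\mathscr P^{\le N_{Mid}-1}v^J\|,\|\mathscr P^{\le N_{Mid}-1}V^J_\alpha\|\le\varepsilon$; $\|\Psi\|\le\mathring\upalpha+\varepsilon^{1/2}$; $\|\breve X\Psi\|\le\mathring A+\varepsilon^{1/2}$; each of $\|\mathscr Z_*^{[1,N_{Mid}];1}\Psi\|$, $\|\mathscr Z^{\le N_{Mid}-1;1}v\|$, $\|\mathscr Z^{\le N_{Mid}-1;1}V\|$, $\|\mathscr P_*^{[1,N_{Mid}-1]}\upmu\|$, $\|\mathscr Z_*^{[1,N_{Mid}-1];1}\upxi_j^{(Small)}\|$, $\|\mathscr Z^{\le N_{Mid}-1;1}\Theta_i^{j,(Small)}\|$ is $\le\varepsilon^{1/2}$; $\|\upmu\|\le1+2\mathring A_*^{-1}\|\mathcal G\breve X\Psi\|_{L^\infty(\Sigma_0^u)}+\mathring\upalpha^{1/2}+\varepsilon^{1/2}$;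 $\|L\upmu\|\le\|\mathcal G\breve X\Psi\|_{L^\infty(\Sigma_0^u)}+\varepsilon^{1/2}$; $\|\upxi_j^{(Small)}\|\le\mathring\upalpha^{1/2}+\mathring\upepsilon^{1/2}$; $\|\breve X\upxi_j^{(Small)}\|\le\|\breve X\upxi_j^{(Small)}\|_{L^\infty(\Sigma_0^u)}+\varepsilon^{1/2}$. **Lemma.** There are constants $C_\star,\delta>0$, a positive continuous function $C(\cdot,\cdot)$ that is nondecreasing in both arguments, and continuous increasing functions $f,g:(0,\infty)\to(0,\infty)$, all depending only on $n$, $M$, $N_{Top}$ and the functions $L^\alpha,A^\alpha$, such that the following holds for all $U_0,T_{(Boot)},\tau$, all solutions and all parameters as above with $$\mathring\upalpha<\delta,\qquad 0<\varepsilon<\min\{\delta,\ f(\mathring A^{-1}),\ g(\mathring A_*)\},\qquad 0\le\mathring\upepsilon\le\varepsilon<\mathring\upalpha .$$ First, $\widetilde{\mathcal G}\ne0$, and $\mathcal G\neq0$ on $\mathcal M_{T_{(Boot)},U_0}$. At every point of $\mathcal M_{T_{(Boot)},U_0}$, $$\upmu<\tfrac14\ \Longrightarrow\ \mathcal G\breve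 X\Psi<-\tfrac14\mathring A_*,\qquad\qquad \upmu<\tfrac14\ \Longrightarrow\ |X\Psi|>\frac{1}{8|\widetilde{\mathcal G}|}\,\frac1{\upmu}\,\mathring A_* .$$ If $U_0=1$, then for every $t\in[0,T_{(Boot)})$ the minimum defining $\upmu_\star(t,1)$ is attained and $$\bigl|\upmu_\star(t,1)-(1-t\mathring A_*)\bigr|\le C_\star\,\mathring\upalpha+C(\mathring A,\mathring A_*^{-1})\,\varepsilon ;$$ in particular, if $\upmu_\star(t,1)\to0$ as $t\uparrow T_{(Boot)}$, then $|1-T_{(Boot)}\mathring A_*|\le C_\star\,\mathring\upalpha+C(\mathring A,\mathring A_*^{-1})\,\varepsilon$. -/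

import Mathlib

open Set Filter Topology
open scoped ContDiff

namespace ShockTransport

noncomputable section

/-! Throughout, the number of space dimensions is `n = d + 1` with `d ≥ 0`, and space is
`ℝ × 𝕋^d`. Functions on spacetime `ℝ × ℝ × 𝕋^d` are written as functions on `ℝ^(d+2)` that are
`1`-periodic in the last `d` variables. -/

/-- Coordinate tuples. As a Cartesian tuple: entry `0` is `t = x⁰`, entry `1` is `x¹`, entry `i + 2`
is the torus coordinate `x^(i+2)`. As a geometric tuple: `(t, u, ϑ², …, ϑⁿ)`. -/
abbrev Pt (d : ℕ) : Type := Fin (d + 2) → ℝ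

/-- The position `i + 2` of the `i`-th torus coordinate. -/
def ang {d : ℕ} (i : Fin d) : Fin (d + 2) := i.succ.succ

/-- The coordinate vector `e_α`. -/
def basisVec {d : ℕ} (α : Fin (d + 2)) : Pt d := Pi.single α 1

/-- The coordinate partial derivative `∂_α f` at `x`. -/
def pd {d : ℕ} (α : Fin (d + 2)) (f : Pt d → ℝ) (x : Pt d) : ℝ :=
  fderiv ℝ f x (basisVec α)

/-- The nonlinearities of the system `L^α(Ψ,v) ∂_α Ψ = 0`, `A^α(Ψ,v) ∂_α v = 0`
with their structural assumptions. -/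
structure System (d M : ℕ) where
  L : Fin (d + 2) → ℝ × (Fin M → ℝ) → ℝ
  A : Fin (d + 2) → ℝ × (Fin M → ℝ) → Matrix (Fin M) (Fin M) ℝ
  smooth_L : ∀ α, ContDiff ℝ ∞ (L α)
  smooth_A : ∀ α I J, ContDiff ℝ ∞ (fun s => A α s I J)
  symm_A : ∀ α s, (A α s).IsSymm
  /-- `L⁰ ≡ 1` -/
  L_time : ∀ s, L 0 s = 1
  /-- `L¹ = 1` at the background state `(Ψ,v) = (0,0)` -/
  L_one_background : L 1 0 = 1
  /-- `∂L¹/∂Ψ ≠ 0` for small `(Ψ,v)` -/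
  genuinely_nonlinear : ∀ᶠ s in 𝓝 (0 : ℝ × (Fin M → ℝ)), fderiv ℝ (L 1) s (1, 0) ≠ 0
  posDef_A0 : (A 0 0).PosDef
  posDef_A0_sub_A1 : (A 0 0 - A 1 0).PosDef

namespace System

variable {d M : ℕ} (S : System d M)

/-- `∂L¹/∂Ψ` as a function of `(Ψ,v)`. -/
def dL1 (s : ℝ × (Fin M → ℝ)) : ℝ := fderiv ℝ (S.L 1) s (1, 0)

/-- The blowup-coefficient along `Σ₀` as a function of `(Ψ,v)`: there `u = 1 - x¹`, hence
`μ = 1 / L¹`, `ξ₁ = μ ∂₁u = -1 / L¹`, and the coefficient `(∂L¹/∂Ψ) ξ₁` is as follows. -/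
def blowupInit (s : ℝ × (Fin M → ℝ)) : ℝ := S.dL1 s * (-(1 / S.L 1 s))

/-- The constant `𝒢̃`: the blowup-coefficient at the background value `(Ψ,v) = (0,0)`. -/
def blowupBackground : ℝ := S.blowupInit 0

end System

/-- `{(t,u,ϑ) : 0 ≤ t < T, 0 ≤ u ≤ U}`, the region `[0,T) × [0,U] × 𝕋^d` in geometric
coordinates (lifted to the universal cover); its image in Cartesian coordinates is `ℳ_{T,U}`. -/
def geoRegion {d : ℕ} (T U : ℝ) : Set (Pt d) :=
  {p | 0 ≤ p 0 ∧ p 0 < T ∧ 0 ≤ p 1 ∧ p 1 ≤ U}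

/-- The slice `Σ_t^u` in geometric coordinates. -/
def slice {d : ℕ} (t u : ℝ) : Set (Pt d) :=
  {p | p 0 = t ∧ 0 ≤ p 1 ∧ p 1 ≤ u}

/-- The map `x ↦ (t, u(x), ϑ(x))` from Cartesian to geometric coordinates. -/
def geoCoord {d : ℕ} (u : Pt d → ℝ) (ϑ : Fin d → Pt d → ℝ) (x : Pt d) : Pt d :=
  Fin.cons (x 0) (Fin.cons (u x) (fun i => ϑ i x))

/-- A smooth solution `(Ψ, v)`, together with its eikonal function `u`, its geometric torus
coordinates `ϑ` and its change of variables map `Υ`, on the spacetime region whose description in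
geometric coordinates is `G`; the spacetime region itself is `Υ '' G`. All functions are smooth up
to the boundary of the region, i.e. smooth at each of its points (values away from the region are
irrelevant). `Υ` is a diffeomorphism from `G` onto its image, with inverse `(t, u, ϑ)`. -/
structure Solution {d M : ℕ} (S : System d M) (G : Set (Pt d)) where
  Ψ : Pt d → ℝ
  v : Fin M → Pt d → ℝ
  u : Pt d → ℝ
  ϑ : Fin d → Pt d → ℝ
  Υ : Pt d → Pt d
  smooth_Ψ : ∀ x ∈ Υ '' G, ContDiffAt ℝ ∞ Ψ x
  smooth_v : ∀ x ∈ Υ '' G, ∀ J, ContDiffAt ℝ ∞ (v J) x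
  smooth_u : ∀ x ∈ Υ '' G, ContDiffAt ℝ ∞ u x
  smooth_ϑ : ∀ x ∈ Υ '' G, ∀ i, ContDiffAt ℝ ∞ (ϑ i) x
  smooth_Υ : ∀ p ∈ G, ContDiffAt ℝ ∞ Υ p
  periodic_Ψ : ∀ x i, Ψ (x + basisVec (ang i)) = Ψ x
  periodic_v : ∀ x i J, v J (x + basisVec (ang i)) = v J x
  periodic_u : ∀ x i, u (x + basisVec (ang i)) = u x
  periodic_ϑ : ∀ x i j, ϑ j (x + basisVec (ang i)) = ϑ j x + if i = j then 1 else 0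
  periodic_Υ : ∀ p i, Υ (p + basisVec (ang i)) = Υ p + basisVec (ang i)
  /-- `L Ψ = 0` -/
  eq_Ψ : ∀ x ∈ Υ '' G, ∑ α, S.L α (Ψ x, fun J => v J x) * pd α Ψ x = 0
  /-- `A^α ∂_α v = 0` -/
  eq_v : ∀ x ∈ Υ '' G, ∀ I,
    ∑ α, ∑ J, S.A α (Ψ x, fun K => v K x) I J * pd α (v J) x = 0
  /-- the eikonal equation `L u = 0` -/
  eq_u : ∀ x ∈ Υ '' G, ∑ α, S.L α (Ψ x, fun J => v J x) * pd α u x = 0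
  /-- `u = 1 - x¹` on `Σ₀` -/
  init_u : ∀ x ∈ Υ '' G, x 0 = 0 → u x = 1 - x 1
  /-- `L ϑ^i = 0` -/
  eq_ϑ : ∀ x ∈ Υ '' G, ∀ i, ∑ α, S.L α (Ψ x, fun J => v J x) * pd α (ϑ i) x = 0
  /-- `ϑ^i = x^i` on `Σ₀` -/
  init_ϑ : ∀ x ∈ Υ '' G, x 0 = 0 → ∀ i, ϑ i x = x (ang i)
  /-- `Υ` inverts `x ↦ (t, u, ϑ)` -/
  geoCoord_Υ : ∀ p ∈ G, geoCoord u ϑ (Υ p) = p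

namespace Solution

variable {d M : ℕ} {S : System d M} {G : Set (Pt d)} (s : Solution S G)

/-- The pair `(Ψ, v)` at a point. -/
def state (x : Pt d) : ℝ × (Fin M → ℝ) := (s.Ψ x, fun J => s.v J x)

/-- `V_α^J = ∂_α v^J`. -/
def V (α : Fin (d + 2)) (J : Fin M) : Pt d → ℝ := pd α (s.v J)

/-- The inverse foliation density `μ = 1 / ∂_t u`. -/
def mu (x : Pt d) : ℝ := 1 / pd 0 s.u x

/-- `ξ_j = μ ∂_j u` for the space index `j + 1`, `j : Fin (d + 1)`. -/
def xi (j : Fin (d + 1)) (x : Pt d) : ℝ := s.mu x * pd j.succ s.u x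

/-- `ξ_j^(Small) = ξ_j + δ_j^1`. -/
def xiSmall (j : Fin (d + 1)) (x : Pt d) : ℝ := s.xi j x + if j = 0 then 1 else 0

/-- The blowup-coefficient `𝒢 = (∂L¹/∂Ψ) ξ₁`. -/
def blowup (x : Pt d) : ℝ := S.dL1 (s.state x) * s.xi 0 x

/-- `L f = L^α ∂_α f`. -/
def opL (f : Pt d → ℝ) (x : Pt d) : ℝ := ∑ α, S.L α (s.state x) * pd α f x

/-- `X f = X^j ∂_j f` with `X^j = -L^j` (sum over space indices). -/
def opX (f : Pt d → ℝ) (x : Pt d) : ℝ :=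
  ∑ j : Fin (d + 1), -S.L j.succ (s.state x) * pd j.succ f x

/-- `X̆ = μ X`. -/
def opXb (f : Pt d → ℝ) (x : Pt d) : ℝ := s.mu x * s.opX f x

/-- The derivative `∂/∂ϑ^i` with respect to geometric coordinates, of a function on spacetime. -/
def opTh (i : Fin d) (f : Pt d → ℝ) (x : Pt d) : ℝ :=
  pd (ang i) (f ∘ s.Υ) (geoCoord s.u s.ϑ x)

/-- The perturbed part of the Cartesian component with space index `j + 1` of `∂/∂ϑ^i`:
that component minus a Kronecker delta. -/
def thSmall (i : Fin d) (j : Fin (d + 1)) (x : Pt d) : ℝ :=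
  s.opTh i (fun y => y j.succ) x - if ang i = j.succ then 1 else 0

/-- The commutation vectorfields: `0 ↦ L`, `1 ↦ X̆`, `i + 2 ↦ ∂/∂ϑ^i`. -/
def opZ (k : Fin (d + 2)) : (Pt d → ℝ) → Pt d → ℝ :=
  Fin.cases s.opL (Fin.cases s.opXb (fun i => s.opTh i)) k

/-- A string `Z_{k₁} Z_{k₂} ⋯ Z_{k_N} f` of commutation vectorfields. -/
def string (l : List (Fin (d + 2))) (f : Pt d → ℝ) : Pt d → ℝ :=
  l.foldr s.opZ f

end Solution

/-- Strings `𝒵^{N;1}`: at most one factor `X̆`. -/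
def AdmZ {d : ℕ} (l : List (Fin (d + 2))) : Prop := l.count 1 ≤ 1

/-- Strings `𝒫^N`: no factor `X̆`. -/
def AdmP {d : ℕ} (l : List (Fin (d + 2))) : Prop := l.count 1 = 0

/-- Strings `𝒵_*^{N;1}`: at most one factor `X̆` and at least one factor tangent to the
characteristics. -/
def AdmZStar {d : ℕ} (l : List (Fin (d + 2))) : Prop := l.count 1 ≤ 1 ∧ ∃ k ∈ l, k ≠ 1

/-- Strings `𝒫_*^N`: no factor `X̆`, and at least one factor `∂/∂ϑ^i` or at least two factors
`L`. -/
def AdmPStar {d : ℕ} (l : List (Fin (d + 2))) : Prop :=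
  l.count 1 = 0 ∧ ((∃ i : Fin d, ang i ∈ l) ∨ 2 ≤ l.count 0)

namespace Solution

variable {d M : ℕ} {S : System d M} {G : Set (Pt d)} (s : Solution S G)

open Classical in
/-- The seminorm `∑ |Z^I f|`, summed over all strings of the kind `adm` and of length between
`a` and `b`, as a function on spacetime. -/
def strSum (adm : List (Fin (d + 2)) → Prop) (a b : ℕ) (f : Pt d → ℝ) (x : Pt d) : ℝ :=
  ∑ N ∈ Finset.Icc a b, ∑ I : Fin N → Fin (d + 2),
    if adm (List.ofFn I) then |s.string (List.ofFn I) f x| else 0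

/-- The same seminorm of the array `v`. -/
def strSumv (adm : List (Fin (d + 2)) → Prop) (a b : ℕ) (x : Pt d) : ℝ :=
  ∑ J, s.strSum adm a b (s.v J) x

/-- The same seminorm of the array `V`. -/
def strSumV (adm : List (Fin (d + 2)) → Prop) (a b : ℕ) (x : Pt d) : ℝ :=
  ∑ J, ∑ α, s.strSum adm a b (s.V α J) x

/-- `‖f‖_{L^∞(Σ_t^u)} ≤ B`. All functions considered are continuous, so that the essential
supremum is a supremum. -/
def LinfLE (f : Pt d → ℝ) (t u B : ℝ) : Prop := ∀ p ∈ slice t u, |f (s.Υ p)| ≤ B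

/-- `‖f‖_{L^∞(Σ_t^u)}`. -/
def linf (f : Pt d → ℝ) (t u : ℝ) : ℝ := sSup ((fun p => |f (s.Υ p)|) '' slice t u)

/-- The function `𝒢 X̆Ψ`. -/
def blowupXbΨ (x : Pt d) : ℝ := s.blowup x * s.opXb s.Ψ x

/-- `Å_* = sup_{Σ_0^1} [𝒢 X̆Ψ]_-`, where `[f]_- = |min {f, 0}|`. -/
def Astar : ℝ := sSup ((fun p => |min (s.blowupXbΨ (s.Υ p)) 0|) '' slice 0 1)

/-- `μ_⋆(t,u) = min_{Σ_t^u} μ`. -/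
def muStar (t u : ℝ) : ℝ := sInf ((fun p => s.mu (s.Υ p)) '' slice t u)

/-- The `L^∞` data-size assumptions along `Σ_0^1`, with parameters `α̊`, `ε̊`, `Å`. -/
structure DataSize (Nmid : ℕ) (α ε₀ A : ℝ) : Prop where
  Ψ_small : s.LinfLE s.Ψ 0 1 α
  Ψ_deriv : s.LinfLE (s.strSum AdmZStar 1 Nmid s.Ψ) 0 1 ε₀
  v_deriv : s.LinfLE (s.strSumv AdmZ 0 (Nmid - 1)) 0 1 ε₀
  V_deriv : s.LinfLE (s.strSumV AdmZ 0 (Nmid - 1)) 0 1 ε₀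
  XbΨ : s.LinfLE (s.opXb s.Ψ) 0 1 A

/-- The bootstrap assumptions on `ℳ_{T,U₀}`, with bootstrap parameter `ε`. (That the change of
variables map is a diffeomorphism is part of `Solution`.) -/
structure Bootstrap (Nmid : ℕ) (T U₀ α ε ε₀ A : ℝ) : Prop where
  T_pos : 0 < T
  T_le : T ≤ 2 * s.Astar⁻¹
  mu_pos : ∀ p ∈ geoRegion T U₀, 0 < s.mu (s.Υ p)
  /- fundamental assumptions -/
  v_fund : ∀ t ∈ Ico 0 T, ∀ u ∈ Icc 0 U₀, ∀ J,
    s.LinfLE (s.strSum AdmP 0 (Nmid - 1) (s.v J)) t u ε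
  V_fund : ∀ t ∈ Ico 0 T, ∀ u ∈ Icc 0 U₀, ∀ α' J,
    s.LinfLE (s.strSum AdmP 0 (Nmid - 1) (s.V α' J)) t u ε
  /- auxiliary assumptions -/
  Ψ_aux : ∀ t ∈ Ico 0 T, ∀ u ∈ Icc 0 U₀, s.LinfLE s.Ψ t u (α + √ε)
  Ψ_deriv_aux : ∀ t ∈ Ico 0 T, ∀ u ∈ Icc 0 U₀,
    s.LinfLE (s.strSum AdmZStar 1 Nmid s.Ψ) t u (√ε)
  XbΨ_aux : ∀ t ∈ Ico 0 T, ∀ u ∈ Icc 0 U₀, s.LinfLE (s.opXb s.Ψ) t u (A + √ε)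
  v_aux : ∀ t ∈ Ico 0 T, ∀ u ∈ Icc 0 U₀, s.LinfLE (s.strSumv AdmZ 0 (Nmid - 1)) t u (√ε)
  V_aux : ∀ t ∈ Ico 0 T, ∀ u ∈ Icc 0 U₀, s.LinfLE (s.strSumV AdmZ 0 (Nmid - 1)) t u (√ε)
  mu_aux : ∀ t ∈ Ico 0 T, ∀ u ∈ Icc 0 U₀,
    s.LinfLE s.mu t u (1 + 2 * s.Astar⁻¹ * s.linf s.blowupXbΨ 0 u + √α + √ε)
  Lmu_aux : ∀ t ∈ Ico 0 T, ∀ u ∈ Icc 0 U₀,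
    s.LinfLE (s.opL s.mu) t u (s.linf s.blowupXbΨ 0 u + √ε)
  mu_deriv_aux : ∀ t ∈ Ico 0 T, ∀ u ∈ Icc 0 U₀,
    s.LinfLE (s.strSum AdmPStar 1 (Nmid - 1) s.mu) t u (√ε)
  xi_aux : ∀ t ∈ Ico 0 T, ∀ u ∈ Icc 0 U₀, ∀ j, s.LinfLE (s.xiSmall j) t u (√α + √ε₀)
  xi_deriv_aux : ∀ t ∈ Ico 0 T, ∀ u ∈ Icc 0 U₀, ∀ j,
    s.LinfLE (s.strSum AdmZStar 1 (Nmid - 1) (s.xiSmall j)) t u (√ε)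
  Xbxi_aux : ∀ t ∈ Ico 0 T, ∀ u ∈ Icc 0 U₀, ∀ j,
    s.LinfLE (s.opXb (s.xiSmall j)) t u (s.linf (s.opXb (s.xiSmall j)) 0 u + √ε)
  th_aux : ∀ t ∈ Ico 0 T, ∀ u ∈ Icc 0 U₀, ∀ i j,
    s.LinfLE (s.strSum AdmZ 0 (Nmid - 1) (s.thSmall i j)) t u (√ε)

end Solution

/-- `N_Mid = ⌈N_Top / 2⌉ + 1`. -/
def Nmid (Ntop : ℕ) : ℕ := (Ntop + 1) / 2 + 1

/-- A continuous increasing function `(0,∞) → (0,∞)`, as used in "`a` is small relative to `b`",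
which means `a < f b`. -/
def IsSmallnessFun (f : ℝ → ℝ) : Prop :=
  ContinuousOn f (Ioi 0) ∧ StrictMonoOn f (Ioi 0) ∧ ∀ b, 0 < b → 0 < f b

end

end ShockTransport

/-! Write H for 𝒢X̆Ψ. In geometric coordinates L is ∂/∂t (`fderiv_Υ_time`), so every estimate is an
ODE estimate along lines of constant (u, ϑ). The heart of the matter is that Lμ = H + O(ε) and LH =
O(ε), so that μ is almost affine in time: μ = 1 + tH + O(α̊) + O(ε), with H taken either at the
point itself or at its foot on Σ₀ (`SmallSolution.abs_mu_sub_le`). The error O(α̊) comes from μ =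
1/L¹ on Σ₀.

The O(ε) bounds rest on exact identities obtained by differentiating Lu = 0 and LΨ = 0 (`opL_mu`,
`opL_xi`, `opL_opXb_Ψ`). In the equations for ξ and X̆Ψ the derivatives of Ψ combine into factors
(∂_k - ξ_k ∂_t)Ψ. These derivatives annihilate u, hence are combinations of L and the Θ_i
(`tanD_eq`). Now LΨ = 0, and Θ_iΨ is constant in time because Ψ is (`opTh_Ψ_transport`); it keeps
its data size ε̊ ≤ ε, whereas the bootstrap assumptions would only give √ε. The first derivatives of
v are bounded by ε through the fundamental bootstrap assumptions. In Lμ - H there also appear the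
ξ_j with j ≠ 1; they vanish on Σ₀ and grow at most like εt.

The conclusions follow from the affine formula. As tÅ_* ≤ 2, the inequality H ≥ -Å_*/4 would force μ
≥ 1/4; dividing H by 𝒢 and μ bounds XΨ from below. On Σ_t the minimum of μ is governed by the most
negative value of H on Σ₀, which is -Å_* up to a limit. -/

namespace ShockTransport

/-! ### Coordinate derivatives -/

section Coordinates

variable {d : ℕ}

theorem fderiv_eq_sum_pd (f : Pt d → ℝ) (x w : Pt d) :
    fderiv ℝ f x w = ∑ α, w α * pd α f x := by
  conv_lhs => rw [pi_eq_sum_univ' w]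
  simp [pd, basisVec, smul_eq_mul]

theorem contDiffAt_pd {f : Pt d → ℝ} {x : Pt d} (hf : ContDiffAt ℝ ∞ f x) (α : Fin (d + 2)) :
    ContDiffAt ℝ ∞ (pd α f) x :=
  (hf.fderiv_right (by simp)).clm_apply contDiffAt_const

theorem pd_comm {f : Pt d → ℝ} {x : Pt d} (hf : ContDiffAt ℝ ∞ f x) (α β : Fin (d + 2)) :
    pd α (pd β f) x = pd β (pd α f) x := by
  have hd : DifferentiableAt ℝ (fderiv ℝ f) x :=
    (hf.fderiv_right (m := ∞) (by simp)).differentiableAt (by simp)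
  have key : ∀ α β : Fin (d + 2),
      pd α (pd β f) x = fderiv ℝ (fderiv ℝ f) x (basisVec α) (basisVec β) := by
    intro α β
    have h := (hd.hasFDerivAt.clm_apply (hasFDerivAt_const (basisVec β) x)).fderiv
    have h' : pd β f = fun y => fderiv ℝ f y (basisVec β) := rfl
    rw [pd, h', h]
    simp
  rw [key, key]
  exact hf.isSymmSndFDerivAt (by simpa using ENat.LEInfty.out) _ _

theorem pd_periodic {f : Pt d → ℝ} {a : Pt d} {c : ℝ} (hf : ∀ x, f (x + a) = f x + c)
    (α : Fin (d + 2)) (x : Pt d) : pd α f (x + a) = pd α f x := by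
  have h : (fun y => f (y + a)) = fun y => f y + c := funext hf
  unfold pd
  rw [← fderiv_comp_add_right, h, fderiv_add_const]

@[simp] theorem geoCoord_zero (u : Pt d → ℝ) (ϑ : Fin d → Pt d → ℝ) (x : Pt d) :
    geoCoord u ϑ x 0 = x 0 := rfl

@[simp] theorem geoCoord_one (u : Pt d → ℝ) (ϑ : Fin d → Pt d → ℝ) (x : Pt d) :
    geoCoord u ϑ x 1 = u x := rfl

@[simp] theorem geoCoord_ang (u : Pt d → ℝ) (ϑ : Fin d → Pt d → ℝ) (x : Pt d) (i : Fin d) :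
    geoCoord u ϑ x (ang i) = ϑ i x := rfl

theorem coord_cases {P : Fin (d + 2) → Prop} (h0 : P 0) (h1 : P 1) (h : ∀ i, P (ang i)) (α) :
    P α := Fin.cases h0 (Fin.cases h1 h) α

theorem ang_ne_zero (i : Fin d) : ang i ≠ 0 := Fin.succ_ne_zero _

theorem ang_ne_one (i : Fin d) : ang i ≠ 1 := fun h =>
  Fin.succ_ne_zero i (Fin.succ_injective _ h)

theorem ang_injective : Function.Injective (ang : Fin d → Fin (d + 2)) := fun _ _ h =>
  Fin.succ_injective _ (Fin.succ_injective _ h)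

end Coordinates

/-! ### The change of variables and the flow of L -/

namespace Solution

variable {d M : ℕ} {S : System d M} {G : Set (Pt d)} (s : Solution S G)

/-- The components of the vectorfield `L`. -/
def vecL (x : Pt d) : Pt d := fun α => S.L α (s.state x)

theorem fderiv_vecL (f : Pt d → ℝ) (x : Pt d) : fderiv ℝ f x (s.vecL x) = s.opL f x :=
  fderiv_eq_sum_pd f x _

theorem Υ_zero {p : Pt d} (hp : p ∈ G) : s.Υ p 0 = p 0 := by
  simpa using congrFun (s.geoCoord_Υ p hp) 0

theorem u_Υ {p : Pt d} (hp : p ∈ G) : s.u (s.Υ p) = p 1 := by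
  simpa using congrFun (s.geoCoord_Υ p hp) 1

theorem ϑ_Υ {p : Pt d} (hp : p ∈ G) (i : Fin d) : s.ϑ i (s.Υ p) = p (ang i) := by
  simpa using congrFun (s.geoCoord_Υ p hp) (ang i)

theorem differentiableAt_geoCoord {x : Pt d} (hx : x ∈ s.Υ '' G) :
    DifferentiableAt ℝ (geoCoord s.u s.ϑ) x := by
  rw [differentiableAt_pi]
  intro α
  induction α using coord_cases with
  | h0 => exact differentiableAt_apply (𝕜 := ℝ) 0 x
  | h1 => exact (s.smooth_u x hx).differentiableAt (by simp)
  | h i => exact (s.smooth_ϑ x hx i).differentiableAt (by simp)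

theorem fderiv_geoCoord_apply {x : Pt d} (hx : x ∈ s.Υ '' G) (w : Pt d) :
    fderiv ℝ (geoCoord s.u s.ϑ) x w 0 = w 0 ∧
    fderiv ℝ (geoCoord s.u s.ϑ) x w 1 = fderiv ℝ s.u x w ∧
    ∀ i, fderiv ℝ (geoCoord s.u s.ϑ) x w (ang i) = fderiv ℝ (s.ϑ i) x w := by
  have h := hasFDerivAt_pi'.1 (s.differentiableAt_geoCoord hx).hasFDerivAt
  refine ⟨?_, ?_, fun i => ?_⟩
  · exact congrArg (fun g => g w) ((h 0).unique (hasFDerivAt_apply (𝕜 := ℝ) 0 x))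
  · exact congrArg (fun g => g w) (h 1).fderiv.symm
  · exact congrArg (fun g => g w) (h (ang i)).fderiv.symm

theorem fderiv_geoCoord_fderiv_Υ {p : Pt d} (hp : p ∈ interior G) (w : Pt d) :
    fderiv ℝ (geoCoord s.u s.ϑ) (s.Υ p) (fderiv ℝ s.Υ p w) = w := by
  have hpG := interior_subset hp
  have h1 : DifferentiableAt ℝ s.Υ p := (s.smooth_Υ p hpG).differentiableAt (by simp)
  have h2 := s.differentiableAt_geoCoord (mem_image_of_mem s.Υ hpG)
  have h3 := h2.hasFDerivAt.comp p h1.hasFDerivAt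
  have h4 : geoCoord s.u s.ϑ ∘ s.Υ =ᶠ[𝓝 p] id :=
    eventually_of_mem (mem_interior_iff_mem_nhds.1 hp) fun q hq => s.geoCoord_Υ q hq
  have h5 := h3.unique ((hasFDerivAt_id p).congr_of_eventuallyEq h4)
  exact congrArg (fun g => g w) h5

/-- In finite dimension a one-sided inverse of an endomorphism is two-sided. -/
theorem fderiv_Υ_fderiv_geoCoord {p : Pt d} (hp : p ∈ interior G) (w : Pt d) :
    fderiv ℝ s.Υ p (fderiv ℝ (geoCoord s.u s.ϑ) (s.Υ p) w) = w := by
  have h : (fderiv ℝ (geoCoord s.u s.ϑ) (s.Υ p)).toLinearMap ∘ₗ (fderiv ℝ s.Υ p).toLinearMap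
      = LinearMap.id := LinearMap.ext fun w => s.fderiv_geoCoord_fderiv_Υ hp w
  exact LinearMap.congr_fun ((LinearMap.comp_eq_id_comm ℝ (Pt d)).1 h) w

/-- The differential of `Υ` is onto, so `Υ` is open at `p`. This is what allows the equations, which
are only assumed on the image, to be differentiated. -/
theorem eventually_mem_image {p : Pt d} (hp : p ∈ interior G) :
    ∀ᶠ x in 𝓝 (s.Υ p), x ∈ s.Υ '' G := by
  have h := ((s.smooth_Υ p (interior_subset hp)).hasStrictFDerivAt (by simp)).map_nhds_eq_of_surj
    (LinearMap.range_eq_top.2 fun w => ⟨_, s.fderiv_Υ_fderiv_geoCoord hp w⟩)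
  rw [← h]
  exact image_mem_map (mem_interior_iff_mem_nhds.1 hp)

/-- The differential of (t, u, ϑ) maps L to the time direction, since Lt = L⁰ = 1, Lu = 0 and Lϑ =
0; the differential of `Υ` maps it back. -/
theorem fderiv_Υ_time {p : Pt d} (hp : p ∈ interior G) :
    fderiv ℝ s.Υ p (basisVec 0) = s.vecL (s.Υ p) := by
  have hx := mem_image_of_mem s.Υ (interior_subset hp)
  rw [← s.fderiv_Υ_fderiv_geoCoord hp (s.vecL (s.Υ p))]
  congr 1
  obtain ⟨h0, h1, h2⟩ := s.fderiv_geoCoord_apply hx (s.vecL (s.Υ p))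
  funext α
  induction α using coord_cases with
  | h0 => rw [h0]; simp [basisVec, vecL, S.L_time]
  | h1 =>
    rw [h1, fderiv_vecL]
    exact (s.eq_u _ hx).symm
  | h i =>
    rw [h2, fderiv_vecL]
    have := s.eq_ϑ _ hx i
    rw [opL, state, this]
    simp [basisVec, ang_ne_zero]

theorem hasDerivAt_curve {p : Pt d} {t : ℝ} (hp : Function.update p 0 t ∈ interior G)
    {f : Pt d → ℝ} (hf : DifferentiableAt ℝ f (s.Υ (Function.update p 0 t))) :
    HasDerivAt (fun r => f (s.Υ (Function.update p 0 r)))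
      (s.opL f (s.Υ (Function.update p 0 t))) t := by
  have h1 : HasDerivAt (Function.update p 0) (basisVec 0) t := hasDerivAt_update p 0 t
  have h2 := ((s.smooth_Υ _ (interior_subset hp)).differentiableAt (by simp)).hasFDerivAt
  have h3 := hf.hasFDerivAt.comp_hasDerivAt t (h2.comp_hasDerivAt t h1)
  rw [s.fderiv_Υ_time hp, s.fderiv_vecL] at h3
  exact h3

/-- Differentiate Lf = 0 and commute partial derivatives. The coefficient L⁰ ≡ 1 contributes
nothing, so only space indices remain on the right. -/
theorem pd_opL_zero {p : Pt d} (hp : p ∈ interior G) {f : Pt d → ℝ}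
    (hf : ContDiffAt ℝ ∞ f (s.Υ p)) (hL : ∀ x ∈ s.Υ '' G, s.opL f x = 0) (α : Fin (d + 2)) :
    s.opL (pd α f) (s.Υ p) = - ∑ k : Fin (d + 1),
      fderiv ℝ (S.L k.succ) (s.state (s.Υ p)) (pd α s.Ψ (s.Υ p), fun J => s.V α J (s.Υ p))
        * pd k.succ f (s.Υ p) := by
  set x := s.Υ p with hxdef
  have hx : x ∈ s.Υ '' G := mem_image_of_mem s.Υ (interior_subset hp)
  have hst : HasFDerivAt s.state ((fderiv ℝ s.Ψ x).prod
      (ContinuousLinearMap.pi fun J => fderiv ℝ (s.v J) x)) x :=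
    ((s.smooth_Ψ x hx).differentiableAt (by simp)).hasFDerivAt.prodMk
      (hasFDerivAt_pi.2 fun J => ((s.smooth_v x hx J).differentiableAt (by simp)).hasFDerivAt)
  have hterm : ∀ β, HasFDerivAt (fun y => S.L β (s.state y) * pd β f y) _ x := fun β =>
    (((S.smooth_L β).differentiable (by simp) _).hasFDerivAt.comp x hst).mul
      ((contDiffAt_pd hf β).differentiableAt (by simp)).hasFDerivAt
  have hsum := HasFDerivAt.fun_sum (u := Finset.univ) fun β _ => hterm β
  have hzero : (fun y => ∑ β, S.L β (s.state y) * pd β f y) =ᶠ[𝓝 x] fun _ => 0 :=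
    (s.eventually_mem_image hp).mono fun y hy => hL y hy
  have h := hsum.unique ((hasFDerivAt_const (0 : ℝ) x).congr_of_eventuallyEq hzero)
  have h' := congrArg (fun g => g (basisVec α)) h
  have h0 : fderiv ℝ (S.L 0) (s.state x) = 0 := by
    have : S.L 0 = fun _ => 1 := funext S.L_time
    rw [this]; simp
  simp only [Function.comp, _root_.sum_apply, _root_.add_apply,
    _root_.smul_apply, smul_eq_mul, Finset.sum_add_distrib,
    ContinuousLinearMap.comp_apply, _root_.zero_apply] at h'
  rw [Fin.sum_univ_succ (f := fun β => pd β f x * _), h0] at h'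
  have h2 : s.opL (pd α f) x = ∑ β, S.L β (s.state x) * fderiv ℝ (pd β f) x (basisVec α) := by
    unfold opL
    exact Finset.sum_congr rfl fun β _ => by rw [pd_comm hf]; rfl
  rw [h2, eq_neg_iff_add_eq_zero, ← h']
  simp only [_root_.zero_apply, mul_zero, zero_add]
  congr 1
  exact Finset.sum_congr rfl fun k _ => mul_comm _ _

end Solution

/-! ### Exact transport equations along L -/

namespace System

variable {d M : ℕ} (S : System d M)

theorem contDiff_dL1 : ContDiff ℝ ∞ S.dL1 :=
  ((S.smooth_L 1).fderiv_right (m := ∞) (by simp)).clm_apply contDiff_const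

end System

namespace Solution

variable {d M : ℕ} {S : System d M} {G : Set (Pt d)} (s : Solution S G)

/-- The derivative `∂_k f - ξ_k ∂_t f`, tangent to the characteristics. -/
noncomputable def tanD (k : Fin (d + 1)) (f : Pt d → ℝ) (x : Pt d) : ℝ :=
    pd k.succ f x - s.xi k x * pd 0 f x

/-- The derivative `∂_α (L^k(Ψ,v))`, expressed through the derivatives of `Ψ` and `v`. -/
noncomputable def gradL (k : Fin (d + 1)) (α : Fin (d + 2)) (x : Pt d) : ℝ :=
  fderiv ℝ (S.L k.succ) (s.state x) (pd α s.Ψ x, fun J => s.V α J x)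

theorem hasFDerivAt_state {x : Pt d} (hx : x ∈ s.Υ '' G) :
    HasFDerivAt s.state ((fderiv ℝ s.Ψ x).prod
      (ContinuousLinearMap.pi fun J => fderiv ℝ (s.v J) x)) x :=
  ((s.smooth_Ψ x hx).differentiableAt (by simp)).hasFDerivAt.prodMk
    (hasFDerivAt_pi.2 fun J => ((s.smooth_v x hx J).differentiableAt (by simp)).hasFDerivAt)

theorem contDiffAt_state {x : Pt d} (hx : x ∈ s.Υ '' G) : ContDiffAt ℝ ∞ s.state x :=
  (s.smooth_Ψ x hx).prodMk (contDiffAt_pi.2 fun J => s.smooth_v x hx J)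

theorem contDiffAt_mu {x : Pt d} (hx : x ∈ s.Υ '' G) (hμ : 0 < s.mu x) :
    ContDiffAt ℝ ∞ s.mu x := by
  have h : pd 0 s.u x ≠ 0 := fun h => by simp [mu, h] at hμ
  exact contDiffAt_const.div (contDiffAt_pd (s.smooth_u x hx) 0) h

theorem contDiffAt_xi {x : Pt d} (hx : x ∈ s.Υ '' G) (hμ : 0 < s.mu x) (j : Fin (d + 1)) :
    ContDiffAt ℝ ∞ (s.xi j) x :=
  (s.contDiffAt_mu hx hμ).mul (contDiffAt_pd (s.smooth_u x hx) _)

theorem contDiffAt_blowup {x : Pt d} (hx : x ∈ s.Υ '' G) (hμ : 0 < s.mu x) :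
    ContDiffAt ℝ ∞ s.blowup x :=
  (S.contDiff_dL1.contDiffAt.comp x (s.contDiffAt_state hx)).mul (s.contDiffAt_xi hx hμ 0)

theorem contDiffAt_opXb_Ψ {x : Pt d} (hx : x ∈ s.Υ '' G) (hμ : 0 < s.mu x) :
    ContDiffAt ℝ ∞ (s.opXb s.Ψ) x :=
  (s.contDiffAt_mu hx hμ).mul (ContDiffAt.sum fun j _ =>
    ((S.smooth_L j.succ).contDiffAt.comp x (s.contDiffAt_state hx)).neg.mul
      (contDiffAt_pd (s.smooth_Ψ x hx) _))

theorem mu_mul_pd_zero_u {x : Pt d} (hμ : 0 < s.mu x) : s.mu x * pd 0 s.u x = 1 := by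
  have h : pd 0 s.u x ≠ 0 := fun h => by simp [mu, h] at hμ
  simp [mu, h]

theorem opL_mul {f g : Pt d → ℝ} {x : Pt d} (hf : DifferentiableAt ℝ f x)
    (hg : DifferentiableAt ℝ g x) :
    s.opL (fun y => f y * g y) x = s.opL f x * g x + f x * s.opL g x := by
  simp only [← fderiv_vecL, fderiv_fun_mul hf hg]
  simp
  ring

theorem opL_congr {f g : Pt d → ℝ} {x : Pt d} (h : f =ᶠ[𝓝 x] g) : s.opL f x = s.opL g x := by
  simp only [← fderiv_vecL, h.fderiv_eq]

theorem opX_Ψ {x : Pt d} (hx : x ∈ s.Υ '' G) : s.opX s.Ψ x = pd 0 s.Ψ x := by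
  have h := s.eq_Ψ x hx
  rw [Fin.sum_univ_succ, S.L_time] at h
  simp only [opX, state, neg_mul, Finset.sum_neg_distrib]
  linarith

theorem opXb_Ψ {x : Pt d} (hx : x ∈ s.Υ '' G) : s.opXb s.Ψ x = s.mu x * pd 0 s.Ψ x := by
  rw [opXb, opX_Ψ s hx]

theorem opTh_eq {p : Pt d} (hp : p ∈ G) {f : Pt d → ℝ} (hf : DifferentiableAt ℝ f (s.Υ p))
    (i : Fin d) : s.opTh i f (s.Υ p) = fderiv ℝ f (s.Υ p) (fderiv ℝ s.Υ p (basisVec (ang i))) := by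
  have h := ((s.smooth_Υ p hp).differentiableAt (by simp) : DifferentiableAt ℝ s.Υ p)
  rw [opTh, s.geoCoord_Υ p hp, pd, (hf.hasFDerivAt.comp p h.hasFDerivAt).fderiv]
  rfl

/-- The vector e_k - ξ_k e_0 annihilates u because ξ_k ∂_t u = ∂_k u. Its geometric components are
therefore -ξ_k in time, zero in u, and the derivatives of the ϑ^i. -/
theorem tanD_eq {p : Pt d} (hp : p ∈ interior G) (hμ : 0 < s.mu (s.Υ p))
    {f : Pt d → ℝ} (hf : DifferentiableAt ℝ f (s.Υ p))
    (k : Fin (d + 1)) : s.tanD k f (s.Υ p) =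
      - s.xi k (s.Υ p) * s.opL f (s.Υ p)
        + ∑ i, s.tanD k (s.ϑ i) (s.Υ p) * s.opTh i f (s.Υ p) := by
  have hpG := interior_subset hp
  have hx := mem_image_of_mem s.Υ hpG
  set w : Pt d := basisVec k.succ - s.xi k (s.Υ p) • basisVec 0 with hw
  have hD : ∀ g, fderiv ℝ g (s.Υ p) w = s.tanD k g (s.Υ p) := fun g => by
    simp [hw, tanD, pd]
  obtain ⟨h0, h1, h2⟩ := s.fderiv_geoCoord_apply hx w
  have hΦ : fderiv ℝ (geoCoord s.u s.ϑ) (s.Υ p) w =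
      -s.xi k (s.Υ p) • basisVec 0 + ∑ i, s.tanD k (s.ϑ i) (s.Υ p) • basisVec (ang i) := by
    funext α
    induction α using coord_cases with
    | h0 =>
      rw [h0]
      simp [hw, basisVec, Finset.sum_apply, (ang_ne_zero _).symm,
        (Fin.succ_ne_zero _).symm]
    | h1 =>
      rw [h1, hD, tanD]
      have := s.mu_mul_pd_zero_u hμ
      have e : s.xi k (s.Υ p) * pd 0 s.u (s.Υ p) = pd k.succ s.u (s.Υ p) := by
        rw [xi]; linear_combination pd k.succ s.u (s.Υ p) * this
      rw [e]
      simp [basisVec, Finset.sum_apply, (ang_ne_one _).symm]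
    | h i =>
      rw [h2, hD]
      simp [basisVec, Finset.sum_apply, Pi.single_apply, ang_ne_zero, ang_injective.eq_iff]
  rw [← hD f]
  conv_lhs => rw [← s.fderiv_Υ_fderiv_geoCoord hp w, hΦ]
  simp only [map_add, map_sum, map_smul, s.fderiv_Υ_time hp, fderiv_vecL, smul_eq_mul]
  congr 1
  exact Finset.sum_congr rfl fun i _ => by rw [s.opTh_eq hpG hf]

theorem opL_pd_u {p : Pt d} (hp : p ∈ interior G) (α : Fin (d + 2)) : s.opL (pd α s.u) (s.Υ p) =
    - ∑ k, s.gradL k α (s.Υ p) * pd k.succ s.u (s.Υ p) :=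
  s.pd_opL_zero hp (s.smooth_u _ (mem_image_of_mem s.Υ (interior_subset hp))) s.eq_u α

theorem opL_pd_Ψ {p : Pt d} (hp : p ∈ interior G) (α : Fin (d + 2)) : s.opL (pd α s.Ψ) (s.Υ p) =
    - ∑ k, s.gradL k α (s.Υ p) * pd k.succ s.Ψ (s.Υ p) :=
  s.pd_opL_zero hp (s.smooth_Ψ _ (mem_image_of_mem s.Υ (interior_subset hp))) s.eq_Ψ α

/-- Apply L to μ ∂_t u = 1 and insert the equation for L ∂_t u. -/
theorem opL_mu {p : Pt d} (hp : p ∈ interior G) (hμ : 0 < s.mu (s.Υ p)) : s.opL s.mu (s.Υ p) =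
    s.mu (s.Υ p) * ∑ k, s.gradL k 0 (s.Υ p) * s.xi k (s.Υ p) := by
  have hx := mem_image_of_mem s.Υ (interior_subset hp)
  have h0 : pd 0 s.u (s.Υ p) ≠ 0 := fun h => by simp [mu, h] at hμ
  have hu : DifferentiableAt ℝ (pd 0 s.u) (s.Υ p) :=
    (contDiffAt_pd (s.smooth_u _ hx) 0).differentiableAt (by simp)
  have hm : DifferentiableAt ℝ s.mu (s.Υ p) := (s.contDiffAt_mu hx hμ).differentiableAt (by simp)
  have h1 : (fun y => s.mu y * pd 0 s.u y) =ᶠ[𝓝 (s.Υ p)] fun _ => 1 := by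
    filter_upwards [hu.continuousAt.eventually_ne h0] with y hy
    simp [mu, hy]
  have h2 := s.opL_congr h1
  rw [s.opL_mul hm hu, s.opL_pd_u hp] at h2
  have h3 : s.opL (fun _ => 1) (s.Υ p) = 0 := by rw [← fderiv_vecL]; simp
  have h4 := s.mu_mul_pd_zero_u hμ
  have h5 : ∑ k, s.gradL k 0 (s.Υ p) * s.xi k (s.Υ p) =
      s.mu (s.Υ p) * ∑ k, s.gradL k 0 (s.Υ p) * pd k.succ s.u (s.Υ p) := by
    rw [Finset.mul_sum]
    exact Finset.sum_congr rfl fun k _ => by rw [xi]; ring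
  rw [h5]
  rw [h3] at h2
  linear_combination s.mu (s.Υ p) * h2 - s.opL s.mu (s.Υ p) * h4

/-- The contributions of Lμ and of L ∂_j u combine: each bracket is minus the derivative of L^k
along ∂_j - ξ_j ∂_t, so no derivative of Ψ transversal to the characteristics survives. -/
theorem opL_xi {p : Pt d} (hp : p ∈ interior G) (hμ : 0 < s.mu (s.Υ p)) (j : Fin (d + 1)) :
    s.opL (s.xi j) (s.Υ p) =
    ∑ k, s.xi k (s.Υ p) *
      (s.xi j (s.Υ p) * s.gradL k 0 (s.Υ p) - s.gradL k j.succ (s.Υ p)) := by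
  have hx := mem_image_of_mem s.Υ (interior_subset hp)
  have hu : DifferentiableAt ℝ (pd j.succ s.u) (s.Υ p) :=
    (contDiffAt_pd (s.smooth_u _ hx) _).differentiableAt (by simp)
  have hm : DifferentiableAt ℝ s.mu (s.Υ p) := (s.contDiffAt_mu hx hμ).differentiableAt (by simp)
  have h2 : s.opL (s.xi j) (s.Υ p) = _ := s.opL_mul hm hu
  rw [h2, s.opL_pd_u hp, s.opL_mu hp hμ, mul_neg, Finset.mul_sum, Finset.mul_sum, Finset.sum_mul,
    ← sub_eq_add_neg, ← Finset.sum_sub_distrib]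
  exact Finset.sum_congr rfl fun k _ => by simp only [xi]; ring

/-- With X̆Ψ = μ ∂_tΨ, the product rule brings one factor ∂_tΨ from Lμ and one ∂_kΨ from L ∂_tΨ;
their difference is the tangential derivative. This removes the Riccati-type quadratic term. -/
theorem opL_opXb_Ψ {p : Pt d} (hp : p ∈ interior G) (hμ : 0 < s.mu (s.Υ p)) :
    s.opL (s.opXb s.Ψ) (s.Υ p) =
    - ∑ k, s.mu (s.Υ p) * s.gradL k 0 (s.Υ p) * s.tanD k s.Ψ (s.Υ p) := by
  have hx := mem_image_of_mem s.Υ (interior_subset hp)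
  have hu : DifferentiableAt ℝ (pd 0 s.Ψ) (s.Υ p) :=
    (contDiffAt_pd (s.smooth_Ψ _ hx) _).differentiableAt (by simp)
  have hm : DifferentiableAt ℝ s.mu (s.Υ p) := (s.contDiffAt_mu hx hμ).differentiableAt (by simp)
  have h1 : s.opXb s.Ψ =ᶠ[𝓝 (s.Υ p)] fun y => s.mu y * pd 0 s.Ψ y :=
    (s.eventually_mem_image hp).mono fun y hy => s.opXb_Ψ hy
  rw [s.opL_congr h1, s.opL_mul hm hu, s.opL_pd_Ψ hp, s.opL_mu hp hμ, mul_neg, Finset.mul_sum,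
    Finset.mul_sum, Finset.sum_mul, ← sub_eq_add_neg, ← Finset.sum_sub_distrib,
    ← Finset.sum_neg_distrib]
  exact Finset.sum_congr rfl fun k _ => by simp only [tanD]; ring

/-- Since LΨ = 0, differentiating ∂L¹/∂Ψ along L only sees the change of v. -/
theorem opL_blowup {p : Pt d} (hp : p ∈ interior G) (hμ : 0 < s.mu (s.Υ p)) :
    s.opL s.blowup (s.Υ p) =
    fderiv ℝ S.dL1 (s.state (s.Υ p)) (0, fun J => s.opL (s.v J) (s.Υ p)) * s.xi 0 (s.Υ p)
      + S.dL1 (s.state (s.Υ p)) * s.opL (s.xi 0) (s.Υ p) := by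
  have hx := mem_image_of_mem s.Υ (interior_subset hp)
  have h1 : HasFDerivAt (fun y => S.dL1 (s.state y)) _ _ :=
      (S.contDiff_dL1.differentiable (by simp) _).hasFDerivAt.comp _
    (s.hasFDerivAt_state hx)
  have h2 : s.opL s.blowup (s.Υ p) = _ := s.opL_mul h1.differentiableAt
    ((s.contDiffAt_xi hx hμ 0).differentiableAt (by simp))
  rw [h2, ← fderiv_vecL, h1.fderiv]
  have h3 : s.opL s.Ψ (s.Υ p) = 0 := s.eq_Ψ _ hx
  congr 2
  simp only [ContinuousLinearMap.comp_apply, ContinuousLinearMap.prod_apply, fderiv_vecL, h3]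
  congr 2
  funext J
  simp [fderiv_vecL]

end Solution

/-! ### Pointwise estimates for the transport equations -/

namespace Solution

variable {d M : ℕ} {S : System d M} {G : Set (Pt d)} (s : Solution S G)

/-- Pointwise bounds at `x`: the coefficients are bounded by `B`, the tangential derivatives of
`Ψ` and all derivatives of `v` by `ε`, `X̆Ψ` by `a`, and `μ` by `m`. -/
structure PointwiseBounds (B ε a m : ℝ) (x : Pt d) : Prop where
  L_le : ∀ α, |S.L α (s.state x)| ≤ B
  DL_le : ∀ α, ‖fderiv ℝ (S.L α) (s.state x)‖ ≤ B
  DdL1_le : ‖fderiv ℝ S.dL1 (s.state x)‖ ≤ B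
  V_le : ∀ α J, |s.V α J x| ≤ ε
  xi_le : ∀ j, |s.xi j x| ≤ 2
  th_le : ∃ η : ℝ, 2 * d * η ≤ 1 ∧ ∀ i k, |s.thSmall i k x| ≤ η
  Th_Ψ_le : ∀ i, |s.opTh i s.Ψ x| ≤ ε
  XbΨ_le : |s.opXb s.Ψ x| ≤ a
  mu_pos : 0 < s.mu x
  mu_le : s.mu x ≤ m
  eps_nonneg : 0 ≤ ε

/-- A bound for the size of the tangential components of the characteristic frame. -/
def tanBound (d : ℕ) (B : ℝ) : ℝ := 2 * d * (1 + 2 * B)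

/-- A bound for the coefficient of `ε` in `L ξ`. -/
def xiBound (d : ℕ) (B : ℝ) : ℝ := (d + 1) * (2 * (B * (tanBound d B + 3)))

theorem abs_clm_pair_le {F : ℝ × (Fin M → ℝ) →L[ℝ] ℝ} {B r c : ℝ} {w : Fin M → ℝ} (hF : ‖F‖ ≤ B)
    {b : ℝ} (hc : |c| ≤ b) (hr : 0 ≤ r) (hw : ∀ J, |w J| ≤ r) : |F (c, w)| ≤ B * (b + r) := by
  have h1 : ‖(c, w)‖ ≤ b + r := by
    have : ‖w‖ ≤ r := (pi_norm_le_iff_of_nonneg hr).2 hw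
    have hb : 0 ≤ b := (abs_nonneg c).trans hc
    exact max_le (by simpa using hc.trans (by linarith)) (this.trans (by linarith))
  calc |F (c, w)| ≤ ‖F‖ * ‖(c, w)‖ := F.le_opNorm _
    _ ≤ B * (b + r) := mul_le_mul hF h1 (norm_nonneg _) ((norm_nonneg _).trans hF)

theorem abs_sum_fin_le {n : ℕ} {F : Fin n → ℝ} {b : ℝ} (h : ∀ k, |F k| ≤ b) :
    |∑ k, F k| ≤ n * b :=
  calc |∑ k, F k| ≤ ∑ k, |F k| := Finset.abs_sum_le_sum_abs _ _
    _ ≤ ∑ _k : Fin n, b := Finset.sum_le_sum fun k _ => h k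
    _ = n * b := by simp

theorem pd_coord (α β : Fin (d + 2)) (x : Pt d) :
    pd α (fun y => y β) x = if α = β then 1 else 0 := by
  have : fderiv ℝ (fun y : Pt d => y β) x = ContinuousLinearMap.proj β :=
    (hasFDerivAt_apply (𝕜 := ℝ) β x).fderiv
  rw [pd, this]
  simp [basisVec, Pi.single_apply, eq_comm]

theorem opL_coord (β : Fin (d + 2)) (x : Pt d) : s.opL (fun y => y β) x = S.L β (s.state x) := by
  simp [opL, pd_coord]

/-- The weight μ turns ∂_tΨ, which may be large where μ is small, into the bounded quantity X̆Ψ. -/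
theorem mu_mul_gradL {x : Pt d} (hx : x ∈ s.Υ '' G) (k : Fin (d + 1)) :
    s.mu x * s.gradL k 0 x =
      fderiv ℝ (S.L k.succ) (s.state x) (s.opXb s.Ψ x, fun J => s.mu x * s.V 0 J x) := by
  rw [s.opXb_Ψ hx, gradL, ← smul_eq_mul, ← map_smul]
  rfl

theorem tanD_gradL {x : Pt d} (j k : Fin (d + 1)) :
    s.xi j x * s.gradL k 0 x - s.gradL k j.succ x =
      - fderiv ℝ (S.L k.succ) (s.state x)
        (s.tanD j s.Ψ x, fun J => s.V j.succ J x - s.xi j x * s.V 0 J x) := by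
  rw [gradL, gradL, ← smul_eq_mul, ← map_smul, ← map_sub, ← map_neg]
  congr 1
  ext
  · simp [tanD]
  · simp

namespace PointwiseBounds

variable {s} {B ε a m : ℝ} {p : Pt d}

theorem B_nonneg {x : Pt d} (hb : s.PointwiseBounds B ε a m x) : 0 ≤ B :=
  (abs_nonneg _).trans (hb.L_le 0)

theorem tanBound_nonneg {x : Pt d} (hb : s.PointwiseBounds B ε a m x) : 0 ≤ tanBound d B := by
  have := hb.B_nonneg
  unfold tanBound
  positivity

theorem xiBound_nonneg {x : Pt d} (hb : s.PointwiseBounds B ε a m x) : 0 ≤ xiBound d B := by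
  have := hb.B_nonneg
  have := hb.tanBound_nonneg
  unfold xiBound
  positivity

theorem abs_dL1_le {x : Pt d} (hb : s.PointwiseBounds B ε a m x) :
    |S.dL1 (s.state x)| ≤ B := by
  have h := abs_clm_pair_le (w := 0) (hb.DL_le 1) (c := 1) (b := 1) (by simp) le_rfl (by simp)
  simpa [System.dL1] using h

/-- The tangential derivative of the Cartesian coordinate x^j is known and at most 1 in size.
Expanding it by `tanD_eq` gives a linear system for the components of ϑ whose matrix is the identity
plus `thSmall`; after summation the perturbation is absorbed because dη ≤ 1/2. -/
theorem sum_abs_tanD_ϑ_le (hp : p ∈ interior G) (hb : s.PointwiseBounds B ε a m (s.Υ p))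
    (k : Fin (d + 1)) : ∑ i, |s.tanD k (s.ϑ i) (s.Υ p)| ≤ tanBound d B := by
  obtain ⟨η, hη, hth⟩ := hb.th_le
  have hB := hb.B_nonneg
  set c : Fin d → ℝ := fun i => s.tanD k (s.ϑ i) (s.Υ p) with hc
  have key : ∀ j, |c j| ≤ (1 + 2 * B) + η * ∑ i, |c i| := by
    intro j
    have h := s.tanD_eq hp hb.mu_pos (f := fun y => y (ang j))
      (differentiableAt_apply (𝕜 := ℝ) (ang j) _) k
    have hTh : ∀ i, s.opTh i (fun y => y (ang j)) (s.Υ p) =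
        s.thSmall i j.succ (s.Υ p) + if i = j then 1 else 0 := by
      intro i
      have e : (ang i = j.succ.succ) = (i = j) := propext ang_injective.eq_iff
      simp only [thSmall, e, sub_add_cancel]
      rfl
    simp only [hTh, mul_add, Finset.sum_add_distrib, opL_coord] at h
    simp only [mul_ite, mul_one, mul_zero, Finset.sum_ite_eq', Finset.mem_univ, if_true] at h
    have h1 : |s.tanD k (fun y => y (ang j)) (s.Υ p)| ≤ 1 := by
      simp only [tanD, pd_coord, (ang_ne_zero j).symm, if_false, mul_zero, sub_zero]
      split_ifs <;> simp
    have h2 : |s.xi k (s.Υ p) * S.L (ang j) (s.state (s.Υ p))| ≤ 2 * B := by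
      rw [abs_mul]
      exact mul_le_mul (hb.xi_le k) (hb.L_le _) (abs_nonneg _) (by norm_num)
    have h3 : |∑ i, c i * s.thSmall i j.succ (s.Υ p)| ≤ η * ∑ i, |c i| := by
      rw [Finset.mul_sum]
      refine (Finset.abs_sum_le_sum_abs _ _).trans (Finset.sum_le_sum fun i _ => ?_)
      rw [abs_mul, mul_comm]
      exact mul_le_mul_of_nonneg_right (hth _ _) (abs_nonneg _)
    rw [abs_le] at h1 h2 h3 ⊢
    constructor <;> linarith
  have hsum : ∑ j, |c j| ≤ d * ((1 + 2 * B) + η * ∑ i, |c i|) :=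
    (Finset.sum_le_sum fun j _ => key j).trans_eq (by
      rw [Finset.sum_const, Finset.card_univ, Fintype.card_fin, nsmul_eq_mul])
  have h0 : 0 ≤ ∑ i, |c i| := Finset.sum_nonneg fun i _ => abs_nonneg _
  unfold tanBound
  nlinarith

theorem abs_tanD_Ψ_le (hp : p ∈ interior G) (hb : s.PointwiseBounds B ε a m (s.Υ p))
    (k : Fin (d + 1)) : |s.tanD k s.Ψ (s.Υ p)| ≤ tanBound d B * ε := by
  have hx := mem_image_of_mem s.Υ (interior_subset hp)
  have h0 : s.opL s.Ψ (s.Υ p) = 0 := s.eq_Ψ _ hx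
  rw [s.tanD_eq hp hb.mu_pos ((s.smooth_Ψ _ hx).differentiableAt (by simp)), h0, mul_zero, zero_add]
  calc |∑ i, s.tanD k (s.ϑ i) (s.Υ p) * s.opTh i s.Ψ (s.Υ p)|
      ≤ ∑ i, |s.tanD k (s.ϑ i) (s.Υ p)| * ε :=
        (Finset.abs_sum_le_sum_abs _ _).trans (Finset.sum_le_sum fun i _ => by
          rw [abs_mul]
          exact mul_le_mul_of_nonneg_left (hb.Th_Ψ_le i) (abs_nonneg _))
    _ = (∑ i, |s.tanD k (s.ϑ i) (s.Υ p)|) * ε := by rw [Finset.sum_mul]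
    _ ≤ tanBound d B * ε := mul_le_mul_of_nonneg_right (hb.sum_abs_tanD_ϑ_le hp k) hb.eps_nonneg

theorem abs_mul_le {b c x y : ℝ} (hx : |x| ≤ b) (hy : |y| ≤ c) : |x * y| ≤ b * c := by
  rw [abs_mul]
  exact mul_le_mul hx hy (abs_nonneg _) ((abs_nonneg _).trans hx)

theorem abs_opL_xi_le (hp : p ∈ interior G) (hb : s.PointwiseBounds B ε a m (s.Υ p))
    (j : Fin (d + 1)) : |s.opL (s.xi j) (s.Υ p)| ≤ xiBound d B * ε := by
  rw [s.opL_xi hp hb.mu_pos]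
  have h : ∀ k, |s.xi k (s.Υ p) *
      (s.xi j (s.Υ p) * s.gradL k 0 (s.Υ p) - s.gradL k j.succ (s.Υ p))|
        ≤ 2 * (B * (tanBound d B * ε + 3 * ε)) := by
    intro k
    refine abs_mul_le (hb.xi_le k) ?_
    rw [tanD_gradL, abs_neg]
    refine abs_clm_pair_le (hb.DL_le _) (hb.abs_tanD_Ψ_le hp j) (by linarith [hb.eps_nonneg])
      fun J => ?_
    have h1 := abs_mul_le (hb.xi_le j) (hb.V_le 0 J)
    have h2 := hb.V_le j.succ J
    rw [abs_le] at h1 h2 ⊢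
    constructor <;> linarith
  refine (abs_sum_fin_le h).trans (le_of_eq ?_)
  unfold xiBound
  push_cast
  ring

theorem abs_mu_gradL_le (hp : p ∈ interior G) (hb : s.PointwiseBounds B ε a m (s.Υ p))
    (k : Fin (d + 1)) : |s.mu (s.Υ p) * s.gradL k 0 (s.Υ p)| ≤ B * (a + m * ε) := by
  have hm : 0 ≤ m := hb.mu_pos.le.trans hb.mu_le
  have hx := mem_image_of_mem s.Υ (interior_subset hp)
  rw [s.mu_mul_gradL hx]
  exact abs_clm_pair_le (hb.DL_le _) hb.XbΨ_le (mul_nonneg hm hb.eps_nonneg) fun J =>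
    abs_mul_le (by rw [abs_of_pos hb.mu_pos]; exact hb.mu_le) (hb.V_le _ _)

theorem abs_opL_opXb_Ψ_le (hp : p ∈ interior G) (hb : s.PointwiseBounds B ε a m (s.Υ p)) :
    |s.opL (s.opXb s.Ψ) (s.Υ p)| ≤ (d + 1) * (B * (a + m * ε) * (tanBound d B * ε)) := by
  rw [s.opL_opXb_Ψ hp hb.mu_pos, abs_neg]
  refine (abs_sum_fin_le fun k =>
    abs_mul_le (hb.abs_mu_gradL_le hp k) (hb.abs_tanD_Ψ_le hp k)).trans (le_of_eq ?_)
  push_cast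
  ring

/-- In the exact formula for Lμ, the Ψ-part of the x¹ summand is precisely 𝒢X̆Ψ. What remains is the
v-part of that summand, and the torus summands, each with a factor ξ_j that the bound r controls. -/
theorem abs_opL_mu_sub_le (hp : p ∈ interior G) (hb : s.PointwiseBounds B ε a m (s.Υ p))
    {r : ℝ} (hr : ∀ j : Fin (d + 1), j ≠ 0 → |s.xi j (s.Υ p)| ≤ r) :
    |s.opL s.mu (s.Υ p) - s.blowupXbΨ (s.Υ p)| ≤
      (B * (m * ε)) * 2 + d * ((B * (a + m * ε)) * r) := by
  have hm : 0 ≤ m := hb.mu_pos.le.trans hb.mu_le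
  have hx := mem_image_of_mem s.Υ (interior_subset hp)
  have e : s.opL s.mu (s.Υ p) - s.blowupXbΨ (s.Υ p) =
      fderiv ℝ (S.L 1) (s.state (s.Υ p)) (0, fun J => s.mu (s.Υ p) * s.V 0 J (s.Υ p))
          * s.xi 0 (s.Υ p)
        + ∑ k : Fin d, s.mu (s.Υ p) * s.gradL k.succ 0 (s.Υ p) * s.xi k.succ (s.Υ p) := by
    rw [s.opL_mu hp hb.mu_pos, Finset.mul_sum, Fin.sum_univ_succ]
    simp only [← mul_assoc]
    rw [s.mu_mul_gradL hx, blowupXbΨ, blowup, System.dL1]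
    have : (s.opXb s.Ψ (s.Υ p), fun J => s.mu (s.Υ p) * s.V 0 J (s.Υ p)) =
        s.opXb s.Ψ (s.Υ p) • ((1, 0) : ℝ × (Fin M → ℝ))
          + (0, fun J => s.mu (s.Υ p) * s.V 0 J (s.Υ p)) := by
      ext <;> simp
    rw [this, map_add, map_smul, smul_eq_mul, Fin.succ_zero_eq_one]
    ring
  rw [e]
  refine (abs_add_le _ _).trans (add_le_add (abs_mul_le ?_ (hb.xi_le 0)) (abs_sum_fin_le fun k =>
    abs_mul_le (hb.abs_mu_gradL_le hp _) (hr _ (Fin.succ_ne_zero k))))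
  have := abs_clm_pair_le (hb.DL_le 1) (c := 0) (b := 0) (by simp) (mul_nonneg hm hb.eps_nonneg)
    (w := fun J => s.mu (s.Υ p) * s.V 0 J (s.Υ p)) fun J =>
      abs_mul_le (by rw [abs_of_pos hb.mu_pos]; exact hb.mu_le) (hb.V_le _ _)
  simpa using this

theorem abs_blowup_le {x : Pt d} (hb : s.PointwiseBounds B ε a m x) : |s.blowup x| ≤ B * 2 :=
  abs_mul_le hb.abs_dL1_le (hb.xi_le 0)

theorem abs_opL_v_le {x : Pt d} (hb : s.PointwiseBounds B ε a m x) (J : Fin M) :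
    |s.opL (s.v J) x| ≤ (d + 2) * (B * ε) := by
  have := abs_sum_fin_le fun α => abs_mul_le (hb.L_le α) (hb.V_le α J)
  push_cast at this
  exact this

theorem abs_opL_blowup_le (hp : p ∈ interior G) (hb : s.PointwiseBounds B ε a m (s.Υ p)) :
    |s.opL s.blowup (s.Υ p)| ≤ B * ((d + 2) * (B * ε)) * 2 + B * (xiBound d B * ε) := by
  have hB := hb.B_nonneg
  have hε := hb.eps_nonneg
  rw [s.opL_blowup hp hb.mu_pos]
  refine (abs_add_le _ _).trans (add_le_add (abs_mul_le ?_ (hb.xi_le 0))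
    (abs_mul_le hb.abs_dL1_le (hb.abs_opL_xi_le hp 0)))
  have := abs_clm_pair_le hb.DdL1_le (c := 0) (b := 0) (by simp) (by positivity) hb.abs_opL_v_le
  simpa using this

theorem abs_opL_blowupXbΨ_le (hp : p ∈ interior G) (hb : s.PointwiseBounds B ε a m (s.Υ p)) :
    |s.opL s.blowupXbΨ (s.Υ p)| ≤
      (B * ((d + 2) * (B * ε)) * 2 + B * (xiBound d B * ε)) * a
        + B * 2 * ((d + 1) * (B * (a + m * ε) * (tanBound d B * ε))) := by
  have hx := mem_image_of_mem s.Υ (interior_subset hp)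
  have h : s.opL s.blowupXbΨ (s.Υ p) = _ := s.opL_mul
    ((s.contDiffAt_blowup hx hb.mu_pos).differentiableAt (by simp))
    ((s.contDiffAt_opXb_Ψ hx hb.mu_pos).differentiableAt (by simp))
  rw [h]
  exact (abs_add_le _ _).trans (add_le_add (abs_mul_le (hb.abs_opL_blowup_le hp) hb.XbΨ_le)
    (abs_mul_le hb.abs_blowup_le (hb.abs_opL_opXb_Ψ_le hp)))

end PointwiseBounds

end Solution

/-! ### Integration along L and the values on Σ₀ -/

namespace Solution

section Region

variable {d : ℕ}

theorem mem_interior_geoRegion_union {T U : ℝ} (R : Set (Pt d)) {p : Pt d} (h0 : 0 < p 0)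
    (hT : p 0 < T) (h1 : 0 < p 1) (hU : p 1 < U) : p ∈ interior (geoRegion T U ∪ R) := by
  have ho : IsOpen {q : Pt d | (0 < q 0 ∧ q 0 < T) ∧ (0 < q 1 ∧ q 1 < U)} := by
    have c0 : Continuous fun q : Pt d => q 0 := continuous_apply 0
    have c1 : Continuous fun q : Pt d => q 1 := continuous_apply 1
    exact ((isOpen_lt continuous_const c0).inter (isOpen_lt c0 continuous_const)).inter
      ((isOpen_lt continuous_const c1).inter (isOpen_lt c1 continuous_const))
  refine mem_interior.2 ⟨_, fun q hq => Or.inl ?_, ho, ⟨⟨h0, hT⟩, h1, hU⟩⟩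
  exact ⟨hq.1.1.le, hq.1.2, hq.2.1.le, hq.2.2.le⟩

@[simp] theorem update_zero_one (p : Pt d) (r : ℝ) : Function.update p 0 r 1 = p 1 :=
  Function.update_of_ne (by simp) _ _

theorem abs_sub_le_of_abs_deriv_le {F F' : ℝ → ℝ} {b K : ℝ} (hb : 0 ≤ b)
    (hc : ContinuousOn F (Icc 0 b)) (hd : ∀ r ∈ Ioo 0 b, HasDerivAt F (F' r) r)
    (hK : ∀ r ∈ Ioo 0 b, |F' r| ≤ K) : |F b - F 0| ≤ K * b := by
  rcases hb.eq_or_lt with rfl | hb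
  · simp
  obtain ⟨c, hcm, h⟩ := exists_hasDerivAt_eq_slope F F' hb hc hd
  have h2 : F b - F 0 = F' c * b := by rw [h]; field_simp; ring
  rw [h2, abs_mul, abs_of_pos hb]
  exact mul_le_mul_of_nonneg_right (hK c hcm) hb.le

end Region

variable {d M : ℕ} {S : System d M} {T U : ℝ} {R : Set (Pt d)}
  (s : Solution S (geoRegion T U ∪ R))

/-- This is the mean value inequality on a time line. Lf is only needed at interior points, where
the change of variables can be inverted; the time t = 0 is reached by continuity. -/
theorem abs_transport_le {p : Pt d} (h0 : 0 ≤ p 0) (hT : p 0 < T) (h1 : 0 < p 1) (hU : p 1 < U)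
    {f : Pt d → ℝ} {K : ℝ} (hf : ∀ q ∈ geoRegion T U, DifferentiableAt ℝ f (s.Υ q))
    (hK : ∀ q : Pt d, 0 < q 0 → q 0 < T → 0 < q 1 → q 1 < U → |s.opL f (s.Υ q)| ≤ K) :
    |f (s.Υ p) - f (s.Υ (Function.update p 0 0))| ≤ K * p 0 := by
  have hmem : ∀ r, 0 ≤ r → r ≤ p 0 → Function.update p 0 r ∈ geoRegion T U := fun r hr hr' =>
    ⟨by simpa using hr, by simpa using hr'.trans_lt hT, by simpa using h1.le, by simpa using hU.le⟩
  have h := abs_sub_le_of_abs_deriv_le (F := fun r => f (s.Υ (Function.update p 0 r)))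
    (F' := fun r => s.opL f (s.Υ (Function.update p 0 r))) (K := K) h0 ?_ ?_ ?_
  · simpa using h
  · intro r hr
    have hq := hmem r hr.1 hr.2
    have c1 : ContinuousAt (Function.update p 0) r := (hasDerivAt_update p 0 r).continuousAt
    have c2 := (s.smooth_Υ _ (Or.inl hq)).continuousAt
    have c3 := (hf _ hq).continuousAt
    exact (ContinuousAt.comp (f := fun r => s.Υ (Function.update p 0 r)) c3
      (ContinuousAt.comp (f := Function.update p 0) c2 c1)).continuousWithinAt
  · intro r hr
    exact s.hasDerivAt_curve (mem_interior_geoRegion_union R (by simpa using hr.1)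
      (by simpa using hr.2.trans hT) (by simpa using h1) (by simpa using hU))
      (hf _ (hmem r hr.1.le hr.2.le))
  · intro r hr
    exact hK _ (by simpa using hr.1) (by simpa using hr.2.trans hT) (by simpa using h1)
      (by simpa using hU)

theorem Ψ_transport {p : Pt d} (h0 : 0 ≤ p 0) (hT : p 0 < T) (h1 : 0 < p 1) (hU : p 1 < U) :
    s.Ψ (s.Υ p) = s.Ψ (s.Υ (Function.update p 0 0)) := by
  have h := s.abs_transport_le h0 hT h1 hU (f := s.Ψ) (K := 0)
    (fun q hq => (s.smooth_Ψ _ (mem_image_of_mem _ (Or.inl hq))).differentiableAt (by simp))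
    (fun q a b c e => by
      have : s.opL s.Ψ (s.Υ q) = 0 := s.eq_Ψ _ (mem_image_of_mem _ (interior_subset
        (mem_interior_geoRegion_union R a b c e)))
      simp [this])
  rw [zero_mul] at h
  exact sub_eq_zero.1 (abs_nonpos_iff.1 h)

/-- Ψ∘Υ does not depend on time along nearby lines as well, so its ϑ-derivative does not either. No
derivative is lost and no factor √ε enters. -/
theorem opTh_Ψ_transport {p : Pt d} (h0 : 0 ≤ p 0) (hT : p 0 < T) (h1 : 0 < p 1) (hU : p 1 < U)
    (i : Fin d) : s.opTh i s.Ψ (s.Υ p) = s.opTh i s.Ψ (s.Υ (Function.update p 0 0)) := by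
  have hline : ∀ q ∈ geoRegion T U, HasDerivAt (fun r : ℝ => s.Ψ (s.Υ (q + r • basisVec (ang i))))
      (s.opTh i s.Ψ (s.Υ q)) 0 := by
    intro q hq
    have hG : q ∈ geoRegion T U ∪ R := Or.inl hq
    have hd : DifferentiableAt ℝ (s.Ψ ∘ s.Υ) q :=
      ((s.smooth_Ψ _ (mem_image_of_mem _ hG)).differentiableAt (by simp)).comp q
        ((s.smooth_Υ q hG).differentiableAt (by simp))
    rw [opTh, s.geoCoord_Υ q hG, pd]
    exact hd.hasFDerivAt.hasLineDerivAt _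
  have hp : p ∈ geoRegion T U := ⟨h0, hT, h1.le, hU.le⟩
  have hp0 : Function.update p 0 0 ∈ geoRegion T U :=
    ⟨by simp, by simpa using h0.trans_lt hT, by simpa using h1.le, by simpa using hU.le⟩
  have e : (fun r : ℝ => s.Ψ (s.Υ (p + r • basisVec (ang i)))) =
      fun r : ℝ => s.Ψ (s.Υ (Function.update p 0 0 + r • basisVec (ang i))) := by
    funext r
    have z0 : (basisVec (ang i) : Pt d) 0 = 0 := by simp [basisVec, (ang_ne_zero _).symm]
    have z1 : (basisVec (ang i) : Pt d) 1 = 0 := by simp [basisVec, (ang_ne_one _).symm]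
    rw [s.Ψ_transport (p := p + r • basisVec (ang i)) (by simpa [z0]) (by simpa [z0])
      (by simpa [z1]) (by simpa [z1])]
    congr 2
    funext α
    by_cases hα : α = 0
    · subst hα; simp [z0]
    · simp [hα]
  exact (hline p hp).unique (e ▸ hline _ hp0)

theorem Υ_initial {q : Pt d} (hq : q ∈ geoRegion T U ∪ R) (h0 : q 0 = 0) :
    s.Υ q = Function.update q 1 (1 - q 1) := by
  have hx := mem_image_of_mem s.Υ hq
  have hz : s.Υ q 0 = 0 := by rw [s.Υ_zero hq, h0]
  funext α
  induction α using coord_cases with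
  | h0 => rw [hz, Function.update_of_ne (by simp), h0]
  | h1 =>
    have h := s.init_u _ hx hz
    rw [s.u_Υ hq] at h
    rw [Function.update_self]
    linarith
  | h i =>
    rw [Function.update_of_ne (ang_ne_one i), ← s.init_ϑ _ hx hz, s.ϑ_Υ hq]

/-- Displacements in space directions stay in Σ₀, where u = 1 - x¹. The restriction to the interior
in u keeps the displaced points in the region. -/
theorem pd_u_initial {p : Pt d} (hT : 0 < T) (h0 : p 0 = 0) (h1 : 0 < p 1) (hU : p 1 < U)
    (k : Fin (d + 1)) : pd k.succ s.u (s.Υ p) = if k = 0 then -1 else 0 := by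
  have hp : p ∈ geoRegion T U ∪ R := Or.inl ⟨h0.ge, h0 ▸ hT, h1.le, hU.le⟩
  have hx := mem_image_of_mem s.Υ hp
  have hΥ := s.Υ_initial hp h0
  have hline : HasDerivAt (fun r : ℝ => s.u (s.Υ p + r • basisVec k.succ))
      (pd k.succ s.u (s.Υ p)) 0 :=
    ((s.smooth_u _ hx).differentiableAt (by simp)).hasFDerivAt.hasLineDerivAt _
  set c : ℝ := if k = 0 then 1 else 0 with hc
  have hk : (basisVec k.succ : Pt d) 1 = c := by
    have e : (1 : Fin (d + 2)) = k.succ ↔ k = 0 := by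
      rw [← Fin.succ_zero_eq_one, Fin.succ_inj, eq_comm]
    simp only [basisVec, Pi.single_apply, e, hc]
  have hcd : ∀ e ∈ Ioo 0 U, ∀ᶠ r : ℝ in 𝓝 0, e - r * c ∈ Ioo 0 U := fun e he => by
    have : ContinuousAt (fun r : ℝ => e - r * c) 0 := by fun_prop
    exact this.eventually_mem (by simpa using Ioo_mem_nhds he.1 he.2)
  have heq : (fun r : ℝ => s.u (s.Υ p + r • basisVec k.succ)) =ᶠ[𝓝 0] fun r => p 1 - r * c := by
    filter_upwards [hcd _ ⟨h1, hU⟩] with r hr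
    -- The geometric preimage of the displaced point: its u-value is one minus its x¹-coordinate.
    set q : Pt d := Function.update (s.Υ p + r • basisVec k.succ) 1 (p 1 - r * c) with hq
    have hq0 : q 0 = 0 := by
      rw [hq, Function.update_of_ne (by simp)]
      simp [s.Υ_zero hp, h0, basisVec, (Fin.succ_ne_zero k).symm]
    have hq1 : q 1 = p 1 - r * c := by rw [hq, Function.update_self]
    have hqm : q ∈ geoRegion T U ∪ R :=
      Or.inl ⟨hq0.ge, hq0 ▸ hT, hq1 ▸ hr.1.le, hq1 ▸ hr.2.le⟩
    have e : s.Υ q = s.Υ p + r • basisVec k.succ := by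
      rw [s.Υ_initial hqm hq0, hq1, hq, Function.update_idem, Function.update_eq_self_iff]
      simp only [Pi.add_apply, Pi.smul_apply, smul_eq_mul, hk]
      rw [hΥ, Function.update_self]
      ring
    rw [← e, s.u_Υ hqm, hq1]
  have hd : HasDerivAt (fun r : ℝ => p 1 - r * c) (-c) 0 := by
    simpa using ((hasDerivAt_id (0 : ℝ)).mul_const c).const_sub (p 1)
  rw [(hline.congr_of_eventuallyEq heq.symm).unique hd, hc]
  split_ifs <;> simp

/-- On Σ₀ the space derivatives of u are known, and the eikonal equation then determines ∂_t u. -/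
theorem pd_zero_u_initial {p : Pt d} (hT : 0 < T) (h0 : p 0 = 0) (h1 : 0 < p 1) (hU : p 1 < U) :
    pd 0 s.u (s.Υ p) = S.L 1 (s.state (s.Υ p)) := by
  have hp : p ∈ geoRegion T U ∪ R := Or.inl ⟨h0.ge, h0 ▸ hT, h1.le, hU.le⟩
  have h := s.eq_u _ (mem_image_of_mem s.Υ hp)
  rw [Fin.sum_univ_succ, S.L_time] at h
  simp only [s.pd_u_initial hT h0 h1 hU] at h
  simp only [mul_ite, mul_neg, mul_one, mul_zero, Finset.sum_ite_eq', Finset.mem_univ,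
    if_true, Fin.succ_zero_eq_one, one_mul] at h
  rw [state]
  linarith

theorem mu_initial {p : Pt d} (hT : 0 < T) (h0 : p 0 = 0) (h1 : 0 < p 1) (hU : p 1 < U) :
    s.mu (s.Υ p) = 1 / S.L 1 (s.state (s.Υ p)) := by
  rw [mu, s.pd_zero_u_initial hT h0 h1 hU]

theorem xi_initial {p : Pt d} (hT : 0 < T) (h0 : p 0 = 0) (h1 : 0 < p 1) (hU : p 1 < U)
    {j : Fin (d + 1)} (hj : j ≠ 0) : s.xi j (s.Υ p) = 0 := by
  rw [xi, s.pd_u_initial hT h0 h1 hU, if_neg hj, mul_zero]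

/-- The coefficient of `ε` in the bound for `L (𝒢 X̆Ψ)`. -/
def driftBound (d : ℕ) (B a m : ℝ) : ℝ :=
  (B * ((d + 2) * B) * 2 + B * xiBound d B) * a + B * 2 * ((d + 1) * (B * (a + m) * tanBound d B))

/-- The coefficient of `ε` in the bound for `L μ - 𝒢 X̆Ψ` up to time `b`. -/
def sourceBound (d : ℕ) (B a m b : ℝ) : ℝ :=
  B * m * 2 + d * (B * (a + m) * (xiBound d B * b))

variable {s} {B ε a m b : ℝ}

theorem opL_sub_time_mul {f g : Pt d → ℝ} {x : Pt d} (hf : DifferentiableAt ℝ f x)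
    (hg : DifferentiableAt ℝ g x) :
    s.opL (fun y => f y - y 0 * g y) x = s.opL f x - g x - x 0 * s.opL g x := by
  have h0 : DifferentiableAt ℝ (fun y : Pt d => y 0) x := differentiableAt_apply (𝕜 := ℝ) 0 x
  have h1 := s.opL_mul h0 hg
  rw [s.opL_coord, S.L_time] at h1
  have h2 : s.opL (fun y => f y - y 0 * g y) x = s.opL f x - s.opL (fun y => y 0 * g y) x := by
    simp only [← fderiv_vecL, fderiv_fun_sub hf (h0.fun_mul hg)]
    rfl
  rw [h2, h1]
  ring

/-- For torus directions ξ_j starts from zero; this replaces the bootstrap size √α̊ + √ε̊, which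
would be too large in the source of Lμ. -/
theorem abs_xi_le_mul_time (hμ : ∀ q ∈ geoRegion T U, 0 < s.mu (s.Υ q))
    (hb : ∀ q : Pt d, 0 < q 0 → q 0 < T → 0 < q 1 → q 1 < U → s.PointwiseBounds B ε a m (s.Υ q))
    {p : Pt d} (h0 : 0 ≤ p 0) (hT : p 0 < T) (h1 : 0 < p 1) (hU : p 1 < U)
    {j : Fin (d + 1)} (hj : j ≠ 0) : |s.xi j (s.Υ p)| ≤ xiBound d B * ε * p 0 := by
  have h := s.abs_transport_le h0 hT h1 hU (f := s.xi j) (K := xiBound d B * ε)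
    (fun q hq => (s.contDiffAt_xi (mem_image_of_mem _ (Or.inl hq)) (hμ q hq) j).differentiableAt
      (by simp))
    (fun q e1 e2 e3 e4 => (hb q e1 e2 e3 e4).abs_opL_xi_le
      (mem_interior_geoRegion_union R e1 e2 e3 e4) j)
  rwa [s.xi_initial (p := Function.update p 0 0) (h0.trans_lt hT) (by simp) (by simpa using h1)
    (by simpa using hU) hj,
    sub_zero] at h

theorem differentiableAt_blowupXbΨ {x : Pt d} (hx : x ∈ s.Υ '' (geoRegion T U ∪ R))
    (hμ : 0 < s.mu x) : DifferentiableAt ℝ s.blowupXbΨ x :=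
  ((s.contDiffAt_blowup hx hμ).differentiableAt (by simp)).mul
    ((s.contDiffAt_opXb_Ψ hx hμ).differentiableAt (by simp))

theorem abs_opL_blowupXbΨ_le_drift {p : Pt d} (hp : p ∈ interior (geoRegion T U ∪ R))
    (hε : ε ≤ 1) (hb : s.PointwiseBounds B ε a m (s.Υ p)) :
    |s.opL s.blowupXbΨ (s.Υ p)| ≤ driftBound d B a m * ε := by
  have hB := hb.B_nonneg
  have hm : 0 ≤ m := hb.mu_pos.le.trans hb.mu_le
  have h1 := hb.tanBound_nonneg
  have h0 := hb.eps_nonneg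
  refine (hb.abs_opL_blowupXbΨ_le hp).trans ?_
  have h2 : B * (a + m * ε) * (tanBound d B * ε) ≤ B * (a + m) * (tanBound d B * ε) := by
    gcongr
    nlinarith
  calc _ ≤ (B * ((d + 2) * (B * ε)) * 2 + B * (xiBound d B * ε)) * a
        + B * 2 * ((d + 1) * (B * (a + m) * (tanBound d B * ε))) := by gcongr
    _ = driftBound d B a m * ε := by unfold driftBound; ring

theorem abs_blowupXbΨ_sub_le (hε : ε ≤ 1) (hμ : ∀ q ∈ geoRegion T U, 0 < s.mu (s.Υ q))
    (hb : ∀ q : Pt d, 0 < q 0 → q 0 < T → 0 < q 1 → q 1 < U → s.PointwiseBounds B ε a m (s.Υ q))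
    {p : Pt d} (h0 : 0 ≤ p 0) (hT : p 0 < T) (h1 : 0 < p 1) (hU : p 1 < U) :
    |s.blowupXbΨ (s.Υ p) - s.blowupXbΨ (s.Υ (Function.update p 0 0))|
      ≤ driftBound d B a m * ε * p 0 :=
  s.abs_transport_le h0 hT h1 hU
    (fun q hq => differentiableAt_blowupXbΨ (mem_image_of_mem _ (Or.inl hq)) (hμ q hq))
    (fun q e1 e2 e3 e4 =>
      have hq := mem_interior_geoRegion_union R e1 e2 e3 e4
      abs_opL_blowupXbΨ_le_drift hq hε (hb q e1 e2 e3 e4))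

/-- Transport is applied to μ - tH with H = 𝒢X̆Ψ: its L-derivative is (Lμ - H) - t LH, and both
terms are O(ε). -/
theorem abs_mu_sub_le (hε : ε ≤ 1) (hTb : T ≤ b) (hμ : ∀ q ∈ geoRegion T U, 0 < s.mu (s.Υ q))
    (hb : ∀ q : Pt d, 0 < q 0 → q 0 < T → 0 < q 1 → q 1 < U → s.PointwiseBounds B ε a m (s.Υ q))
    {p : Pt d} (h0 : 0 ≤ p 0) (hT : p 0 < T) (h1 : 0 < p 1) (hU : p 1 < U) :
    |s.mu (s.Υ p) - p 0 * s.blowupXbΨ (s.Υ p) - s.mu (s.Υ (Function.update p 0 0))|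
      ≤ (sourceBound d B a m b + b * driftBound d B a m) * ε * p 0 := by
  have hG : ∀ q ∈ geoRegion T U, q ∈ geoRegion T U ∪ R := fun q hq => Or.inl hq
  have h := s.abs_transport_le h0 hT h1 hU (f := fun y => s.mu y - y 0 * s.blowupXbΨ y)
    (K := (sourceBound d B a m b + b * driftBound d B a m) * ε) ?_ ?_
  · have e : s.Υ (Function.update p 0 0) 0 = 0 := by
      rw [s.Υ_zero (hG _ ⟨by simp, by simpa using h0.trans_lt hT, by simpa using h1.le,
        by simpa using hU.le⟩)]
      simp
    rwa [s.Υ_zero (hG p ⟨h0, hT, h1.le, hU.le⟩), e, zero_mul, sub_zero] at h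
  · intro q hq
    have hx := mem_image_of_mem s.Υ (hG q hq)
    exact ((s.contDiffAt_mu hx (hμ q hq)).differentiableAt (by simp)).sub
      ((differentiableAt_apply (𝕜 := ℝ) 0 _).mul (differentiableAt_blowupXbΨ hx (hμ q hq)))
  · intro q e1 e2 e3 e4
    have hq := mem_interior_geoRegion_union R e1 e2 e3 e4
    have hx := mem_image_of_mem s.Υ (interior_subset hq)
    have hbq := hb q e1 e2 e3 e4
    have hB := hbq.B_nonneg
    have hm : 0 ≤ m := hbq.mu_pos.le.trans hbq.mu_le
    have ha : 0 ≤ a := (abs_nonneg _).trans hbq.XbΨ_le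
    have hxi := hbq.xiBound_nonneg
    have hε0 := hbq.eps_nonneg
    rw [opL_sub_time_mul ((s.contDiffAt_mu hx hbq.mu_pos).differentiableAt (by simp))
      (differentiableAt_blowupXbΨ hx hbq.mu_pos), s.Υ_zero (interior_subset hq)]
    have hsrc : |s.opL s.mu (s.Υ q) - s.blowupXbΨ (s.Υ q)| ≤ sourceBound d B a m b * ε := by
      refine (hbq.abs_opL_mu_sub_le hq (r := xiBound d B * ε * b) fun j hj =>
        (abs_xi_le_mul_time hμ hb e1.le e2 e3 e4 hj).trans ?_).trans ?_
      · gcongr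
        linarith
      · have h2 : B * (a + m * ε) * (xiBound d B * ε * b)
            ≤ B * (a + m) * (xiBound d B * ε * b) := by
          have : 0 ≤ b := (e1.trans e2).le.trans hTb
          gcongr
          nlinarith
        calc _ ≤ B * (m * ε) * 2 + d * (B * (a + m) * (xiBound d B * ε * b)) := by gcongr
          _ = sourceBound d B a m b * ε := by unfold sourceBound; ring
    have hdr := abs_opL_blowupXbΨ_le_drift hq hε hbq
    have hq0 : |q 0| ≤ b := by rw [abs_of_pos e1]; linarith
    refine (abs_sub _ _).trans ((add_le_add hsrc (PointwiseBounds.abs_mul_le hq0 hdr)).trans_eq ?_)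
    ring

end Solution

/-! ### Coefficients near the background state -/

namespace System

variable {d M : ℕ} (S : System d M)

/-- `B` bounds the coefficients `L^α` and their derivatives on the unit ball of states. -/
structure CoeffBound (B : ℝ) : Prop where
  one_le : 1 ≤ B
  L_le : ∀ w, ‖w‖ ≤ 1 → ∀ α, |S.L α w| ≤ B
  DL_le : ∀ w, ‖w‖ ≤ 1 → ∀ α, ‖fderiv ℝ (S.L α) w‖ ≤ B
  DdL1_le : ∀ w, ‖w‖ ≤ 1 → ‖fderiv ℝ S.dL1 w‖ ≤ B

theorem exists_coeffBound : ∃ B, S.CoeffBound B := by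
  have hK : IsCompact (Metric.closedBall (0 : ℝ × (Fin M → ℝ)) 1) := isCompact_closedBall 0 1
  have c1 : ∀ α, Continuous fun w => ‖S.L α w‖ := fun α => (S.smooth_L α).continuous.norm
  have c2 : ∀ α, Continuous fun w => ‖fderiv ℝ (S.L α) w‖ := fun α =>
    ((S.smooth_L α).continuous_fderiv (by simp)).norm
  have c3 : Continuous fun w => ‖fderiv ℝ S.dL1 w‖ :=
      (S.contDiff_dL1.continuous_fderiv (by simp)).norm
  set F : ℝ × (Fin M → ℝ) → ℝ := fun w =>
    1 + (∑ α, ‖S.L α w‖ + ∑ α, ‖fderiv ℝ (S.L α) w‖ + ‖fderiv ℝ S.dL1 w‖) with hF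
  have cF : Continuous F := by fun_prop
  obtain ⟨B, hB⟩ := hK.exists_bound_of_continuousOn cF.continuousOn
  have hB' : ∀ w, ‖w‖ ≤ 1 → F w ≤ B := fun w hw =>
    (le_abs_self _).trans (hB w (by simpa using hw))
  have s1 : ∀ w α, ‖S.L α w‖ ≤ ∑ α, ‖S.L α w‖ := fun w α =>
    Finset.single_le_sum (f := fun α => ‖S.L α w‖) (fun _ _ => norm_nonneg _) (Finset.mem_univ α)
  have s2 : ∀ w α, ‖fderiv ℝ (S.L α) w‖ ≤ ∑ α, ‖fderiv ℝ (S.L α) w‖ := fun w α =>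
    Finset.single_le_sum (f := fun α => ‖fderiv ℝ (S.L α) w‖) (fun _ _ => norm_nonneg _)
      (Finset.mem_univ α)
  have n1 := fun w => (norm_nonneg _).trans (s1 w 0)
  have n2 := fun w => (norm_nonneg _).trans (s2 w 0)
  have n3 := fun w => norm_nonneg (fderiv ℝ S.dL1 w)
  refine ⟨B, ?_, fun w hw α => ?_, fun w hw α => ?_, fun w hw => ?_⟩
  · have := hB' 0 (by simp)
    linarith [n1 0, n2 0, n3 0]
  · have := hB' w hw
    rw [← Real.norm_eq_abs]
    linarith [n1 w, n2 w, n3 w, s1 w α]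
  · have := hB' w hw
    linarith [n1 w, n2 w, n3 w, s2 w α]
  · have := hB' w hw
    linarith [n1 w, n2 w, n3 w]

theorem CoeffBound.abs_L_one_sub_le {S : System d M} {B : ℝ} (hB : S.CoeffBound B)
    {w : ℝ × (Fin M → ℝ)} (hw : ‖w‖ ≤ 1) : |S.L 1 w - 1| ≤ B * ‖w‖ := by
  have h := (convex_closedBall (0 : ℝ × (Fin M → ℝ)) 1).norm_image_sub_le_of_norm_fderiv_le
    (𝕜 := ℝ) (f := S.L 1) (C := B) (x := 0) (y := w)
    (fun x _ => (S.smooth_L 1).differentiable (by simp) x)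
    (fun x hx => hB.DL_le x (by simpa using hx) 1) (by simp) (by simpa using hw)
  simpa [S.L_one_background] using h

theorem dL1_zero_ne : S.dL1 0 ≠ 0 := S.genuinely_nonlinear.self_of_nhds

theorem blowupBackground_eq : S.blowupBackground = - S.dL1 0 := by
  simp [blowupBackground, blowupInit, S.L_one_background]

/-- The fraction 1/4 serves twice: it keeps ∂L¹/∂Ψ away from zero and bounds it by 5/4 of its
background size. -/
theorem exists_radius : ∃ r : ℝ, 0 < r ∧ r ≤ 1 ∧
    ∀ w, ‖w‖ < r → |S.dL1 w - S.dL1 0| < |S.dL1 0| / 4 := by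
  have h : ∀ᶠ w in 𝓝 (0 : ℝ × (Fin M → ℝ)), |S.dL1 w - S.dL1 0| < |S.dL1 0| / 4 := by
    have hc : ContinuousAt (fun w => |S.dL1 w - S.dL1 0|) 0 :=
      (S.contDiff_dL1.continuous.sub continuous_const).abs.continuousAt
    refine hc.eventually_lt continuousAt_const ?_
    simpa using S.dL1_zero_ne
  obtain ⟨r, hr, h⟩ := Metric.eventually_nhds_iff.1 h
  refine ⟨min r 1, lt_min hr one_pos, min_le_right _ _, fun w hw => h ?_⟩
  rw [dist_zero_right]
  exact hw.trans_le (min_le_left _ _)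

end System

/-! ### From the bootstrap assumptions to pointwise bounds -/

namespace Solution

section Strings

variable {d M : ℕ} {S : System d M} {G : Set (Pt d)} (s : Solution S G)

theorem abs_string_le_strSum {adm : List (Fin (d + 2)) → Prop} {a b : ℕ}
    {l : List (Fin (d + 2))} (hl : adm l) (ha : a ≤ l.length) (hb : l.length ≤ b) (f : Pt d → ℝ)
    (x : Pt d) : |s.string l f x| ≤ s.strSum adm a b f x := by
  classical
  have h0 : ∀ N (I : Fin N → Fin (d + 2)),
      0 ≤ if adm (List.ofFn I) then |s.string (List.ofFn I) f x| else 0 := by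
    intro N I
    split_ifs <;> simp
  unfold strSum
  refine le_trans ?_ (Finset.single_le_sum (fun N _ => Finset.sum_nonneg fun I _ => h0 N I)
    (Finset.mem_Icc.2 ⟨ha, hb⟩))
  refine le_trans ?_ (Finset.single_le_sum (fun I _ => h0 _ I) (Finset.mem_univ l.get))
  rw [List.ofFn_get, if_pos hl]

theorem abs_le_strSum {adm : List (Fin (d + 2)) → Prop} (h : adm []) (b : ℕ) (f : Pt d → ℝ)
    (x : Pt d) : |f x| ≤ s.strSum adm 0 b f x :=
  s.abs_string_le_strSum (l := []) h le_rfl (Nat.zero_le b) f x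

theorem abs_opTh_le_strSum {b : ℕ} (hb : 1 ≤ b) (i : Fin d) (f : Pt d → ℝ) (x : Pt d) :
    |s.opTh i f x| ≤ s.strSum AdmZStar 1 b f x := by
  have h := s.abs_string_le_strSum (adm := AdmZStar) (a := 1) (b := b) (l := [ang i])
    ⟨by simp [ang_ne_one], ang i, by simp, ang_ne_one i⟩ le_rfl hb f x
  exact h

end Strings

variable {d M : ℕ} {S : System d M} {T U : ℝ} {R : Set (Pt d)}
  {s : Solution S (geoRegion T U ∪ R)} {N : ℕ} {α ε ε₀ A B : ℝ}

theorem state_norm_le (hbs : s.Bootstrap N T U α ε ε₀ A) (hε : 0 ≤ ε) (hε1 : ε ≤ 1) (hα : 0 ≤ α)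
    {q : Pt d} (hq : q ∈ geoRegion T U) : ‖s.state (s.Υ q)‖ ≤ α + √ε := by
  have ht : q 0 ∈ Ico 0 T := ⟨hq.1, hq.2.1⟩
  have hu : q 1 ∈ Icc 0 U := ⟨hq.2.2.1, hq.2.2.2⟩
  have hs : q ∈ slice (q 0) (q 1) := ⟨rfl, hu.1, le_rfl⟩
  have h1 := hbs.Ψ_aux _ ht _ hu _ hs
  have hsq : ε ≤ √ε := Real.le_sqrt_of_sq_le (by nlinarith)
  refine max_le (show |s.Ψ (s.Υ q)| ≤ _ from h1) ((pi_norm_le_iff_of_nonneg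
      (by positivity)).2 fun J => ?_)
  have h2 := (le_abs_self _).trans (hbs.v_fund _ ht _ hu J _ hs)
  have h3 := s.abs_le_strSum (adm := AdmP) rfl (N - 1) (s.v J) (s.Υ q)
  change |s.v J (s.Υ q)| ≤ _
  linarith

theorem abs_xiSmall_le (hbs : s.Bootstrap N T U α ε ε₀ A) {q : Pt d} (hq : q ∈ geoRegion T U)
    (j : Fin (d + 1)) : |s.xiSmall j (s.Υ q)| ≤ √α + √ε₀ :=
  hbs.xi_aux _ ⟨hq.1, hq.2.1⟩ _ ⟨hq.2.2.1, hq.2.2.2⟩ j _ ⟨rfl, hq.2.2.1, le_rfl⟩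

theorem abs_xi_le_two (hbs : s.Bootstrap N T U α ε ε₀ A) (hsm : √α + √ε₀ ≤ 1 / 4) {q : Pt d}
    (hq : q ∈ geoRegion T U) (j : Fin (d + 1)) : |s.xi j (s.Υ q)| ≤ 2 := by
  have h := (abs_xiSmall_le hbs hq j).trans hsm
  unfold xiSmall at h
  rw [abs_le] at h ⊢
  split_ifs at h <;> constructor <;> linarith

theorem abs_blowup_le_of_bootstrap (hB : S.CoeffBound B) (hbs : s.Bootstrap N T U α ε ε₀ A)
    (hε : 0 ≤ ε) (hε1 : ε ≤ 1) (hα : 0 ≤ α) (hst : α + √ε ≤ 1) (hsm : √α + √ε₀ ≤ 1 / 4) {q : Pt d}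
    (hq : q ∈ geoRegion T U) : |s.blowup (s.Υ q)| ≤ B * 2 := by
  have hn := (state_norm_le hbs hε hε1 hα hq).trans hst
  refine PointwiseBounds.abs_mul_le ?_ (abs_xi_le_two hbs hsm hq 0)
  have h := abs_clm_pair_le (w := 0) (hB.DL_le _ hn 1) (c := 1) (b := 1) (by simp) le_rfl (by simp)
  simpa [System.dL1] using h

theorem abs_blowupXbΨ_initial_le (hB : S.CoeffBound B) (hds : s.DataSize N α ε₀ A)
    (hbs : s.Bootstrap N T U α ε ε₀ A) (hε : 0 ≤ ε) (hε1 : ε ≤ 1) (hα : 0 ≤ α) (hst : α + √ε ≤ 1)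
    (hsm : √α + √ε₀ ≤ 1 / 4) (hU1 : U ≤ 1) {u : ℝ} (hu : u ≤ U) {q : Pt d} (hq : q ∈ slice 0 u) :
    |s.blowupXbΨ (s.Υ q)| ≤ B * 2 * A :=
  PointwiseBounds.abs_mul_le (abs_blowup_le_of_bootstrap hB hbs hε hε1 hα hst hsm
    ⟨hq.1.ge, hq.1 ▸ hbs.T_pos, hq.2.1, hq.2.2.trans hu⟩)
    (hds.XbΨ q ⟨hq.1, hq.2.1, hq.2.2.trans (hu.trans hU1)⟩)

theorem pointwiseBounds_of_bootstrap (hB : S.CoeffBound B) (hds : s.DataSize N α ε₀ A)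
    (hbs : s.Bootstrap N T U α ε ε₀ A) (hN : 1 ≤ N) (hA : 0 < A) (hAs : 0 < s.Astar)
    (hε : 0 ≤ ε) (hεε : ε₀ ≤ ε) (hα : 0 ≤ α) (hα1 : α ≤ 1) (hε1 : ε ≤ 1) (hst : α + √ε ≤ 1)
    (hsm : √α + √ε₀ ≤ 1 / 4) (hd : 2 * d * √ε ≤ 1) (hU1 : U ≤ 1)
    {q : Pt d} (h0 : 0 < q 0) (hT : q 0 < T) (h1 : 0 < q 1) (hU : q 1 < U) :
    s.PointwiseBounds B ε (A + 1) (3 + 4 * B * A * s.Astar⁻¹) (s.Υ q) := by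
  have hq : q ∈ geoRegion T U := ⟨h0.le, hT, h1.le, hU.le⟩
  have ht : q 0 ∈ Ico 0 T := ⟨hq.1, hq.2.1⟩
  have hu : q 1 ∈ Icc 0 U := ⟨hq.2.2.1, hq.2.2.2⟩
  have hs : q ∈ slice (q 0) (q 1) := ⟨rfl, hu.1, le_rfl⟩
  have hn := (state_norm_le hbs hε hε1 hα hq).trans hst
  have hsε : √ε ≤ 1 := Real.sqrt_le_one.2 hε1
  have hsα : √α ≤ 1 := Real.sqrt_le_one.2 hα1
  have hB1 := hB.one_le
  refine ⟨hB.L_le _ hn, hB.DL_le _ hn, hB.DdL1_le _ hn, fun α' J => ?_,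
    abs_xi_le_two hbs hsm hq, ⟨√ε, hd, fun i k => ?_⟩, fun i => ?_, ?_, hbs.mu_pos q hq, ?_, hε⟩
  · exact (s.abs_le_strSum (adm := AdmP) rfl (N - 1) _ _).trans
      ((le_abs_self _).trans (hbs.V_fund _ ht _ hu α' J _ hs))
  · exact (s.abs_le_strSum (adm := AdmZ) (Nat.zero_le _) (N - 1) _ _).trans
      ((le_abs_self _).trans (hbs.th_aux _ ht _ hu i k _ hs))
  -- The bound must be ε, so it is taken from the data along Σ₀ and not from the bootstrap
  -- assumption.
  · rw [s.opTh_Ψ_transport h0.le hT h1 hU]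
    refine (s.abs_opTh_le_strSum hN i _ _).trans ((le_abs_self _).trans
      ((hds.Ψ_deriv _ ⟨by simp, ?_, ?_⟩).trans hεε))
    · simpa using h1.le
    · simpa using hU.le.trans hU1
  · exact (hbs.XbΨ_aux _ ht _ hu _ hs).trans (by linarith)
  -- On Σ₀ one has |𝒢| ≤ 2B and |X̆Ψ| ≤ Å, which makes the bootstrap bound for μ explicit.
  · have h := (le_abs_self _).trans (hbs.mu_aux _ ht _ hu _ hs)
    have hl : s.linf s.blowupXbΨ 0 (q 1) ≤ B * 2 * A := by
      refine Real.sSup_le ?_ (by positivity)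
      rintro _ ⟨q', hq', rfl⟩
      exact abs_blowupXbΨ_initial_le hB hds hbs hε hε1 hα hst hsm hU1 hU.le hq'
    have h2 : 2 * s.Astar⁻¹ * s.linf s.blowupXbΨ 0 (q 1) ≤ 2 * s.Astar⁻¹ * (B * 2 * A) := by
      gcongr
    calc s.mu (s.Υ q) ≤ _ := h
      _ ≤ 1 + 2 * s.Astar⁻¹ * (B * 2 * A) + 1 + 1 := by gcongr
      _ = _ := by ring

/-- Moving u slightly towards U/2 brings any point of the region to the interior in u, and
continuity passes to the limit. -/
theorem le_of_forall_interior {F : Pt d → ℝ} {E : ℝ} (hU : 0 < U) {p : Pt d}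
    (hp : p ∈ geoRegion T U) (hc : ContinuousAt F p)
    (h : ∀ q : Pt d, 0 ≤ q 0 → q 0 < T → 0 < q 1 → q 1 < U → F q ≤ E) : F p ≤ E := by
  set c : ℝ → Pt d := fun r => Function.update p 1 (p 1 + r * (U / 2 - p 1)) with hcdef
  have hcc : Continuous c := continuous_const.update 1 (by fun_prop)
  have hc0 : c 0 = p := by simp [hcdef]
  have hF : Tendsto (fun r => F (c r)) (𝓝[>] 0) (𝓝 (F p)) := by
    have h1 : Tendsto c (𝓝[>] 0) (𝓝 p) := by
      have := hcc.tendsto 0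
      rw [hc0] at this
      exact this.mono_left nhdsWithin_le_nhds
    exact hc.tendsto.comp h1
  refine le_of_tendsto hF ?_
  filter_upwards [Ioo_mem_nhdsGT (zero_lt_one (α := ℝ))] with r hr
  have e0 : c r 0 = p 0 := Function.update_of_ne (by simp) _ _
  have e1 : c r 1 = p 1 + r * (U / 2 - p 1) := Function.update_self _ _ _
  have h2 := hp.2.2.1
  have h3 := hp.2.2.2
  refine h _ (e0 ▸ hp.1) (e0 ▸ hp.2.1) ?_ ?_ <;> rw [e1] <;> nlinarith [hr.1, hr.2]

end Solution

/-! ### Bookkeeping of the constants -/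

theorem driftBound_le {d : ℕ} {B a m Q : ℝ} (hB : 1 ≤ B) (ha : a ≤ Q) (hm : m ≤ (3 + 4 * B) * Q) :
    Solution.driftBound d B a m ≤ Solution.driftBound d B 1 (3 + 4 * B) * Q := by
  have h1 : 0 ≤ Solution.tanBound d B := by unfold Solution.tanBound; positivity
  have h2 : 0 ≤ Solution.xiBound d B := by unfold Solution.xiBound; positivity
  unfold Solution.driftBound
  calc _ ≤ (B * ((d + 2) * B) * 2 + B * Solution.xiBound d B) * Q
        + B * 2 * ((d + 1) * (B * (Q + (3 + 4 * B) * Q) * Solution.tanBound d B)) := by gcongr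
    _ = _ := by ring

theorem sourceBound_le {d : ℕ} {B a m b Q : ℝ} (hB : 1 ≤ B) (hQ : 1 ≤ Q) (ha : a ≤ Q)
    (hm : m ≤ (3 + 4 * B) * Q) (hb0 : 0 ≤ b) (hb : b ≤ 2 * Q) :
    Solution.sourceBound d B a m b ≤ Solution.sourceBound d B 1 (3 + 4 * B) 2 * Q ^ 2 := by
  have h1 : 0 ≤ Solution.tanBound d B := by unfold Solution.tanBound; positivity
  have h2 : 0 ≤ Solution.xiBound d B := by unfold Solution.xiBound; positivity
  have hQQ : Q ≤ Q ^ 2 := by nlinarith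
  unfold Solution.sourceBound
  calc _ ≤ B * ((3 + 4 * B) * Q ^ 2) * 2
        + d * (B * (Q + (3 + 4 * B) * Q) * (Solution.xiBound d B * (2 * Q))) := by
          gcongr
          exact hm.trans (by gcongr)
    _ = _ := by ring

/-- The system-dependent coefficient of the error terms of size `ε`. -/
def errorCoeff (d : ℕ) (B : ℝ) : ℝ :=
  2 * (Solution.sourceBound d B 1 (3 + 4 * B) 2 + 2 * Solution.driftBound d B 1 (3 + 4 * B))
    + 4 * Solution.driftBound d B 1 (3 + 4 * B) + 1

theorem errorCoeff_pos {d : ℕ} {B : ℝ} (hB : 1 ≤ B) : 0 < errorCoeff d B := by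
  have h1 : 0 ≤ Solution.tanBound d B := by unfold Solution.tanBound; positivity
  have h2 : 0 ≤ Solution.xiBound d B := by unfold Solution.xiBound; positivity
  unfold errorCoeff Solution.sourceBound Solution.driftBound
  positivity

theorem abs_one_div_sub_one_le {x e : ℝ} (hx : |x - 1| ≤ e) (he : e ≤ 1 / 2) :
    |1 / x - 1| ≤ 2 * e := by
  have h := abs_le.1 hx
  have hx0 : 1 / 2 ≤ x := by linarith
  have hpos : 0 < x := by linarith
  have e1 : 1 / x - 1 = -(x - 1) / x := by field_simp; ring
  rw [e1, abs_div, abs_neg, abs_of_pos hpos, div_le_iff₀ hpos]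
  nlinarith [abs_nonneg (x - 1)]

/-! ### The affine formula for μ and its consequences -/

namespace Solution

variable {d M : ℕ} {S : System d M} {T U : ℝ} {R : Set (Pt d)}
  {s : Solution S (geoRegion T U ∪ R)} {N : ℕ} {α ε ε₀ A B : ℝ}

/-- The data and bootstrap assumptions together with the smallness of the parameters. -/
structure SmallSolution (s : Solution S (geoRegion T U ∪ R)) (N : ℕ) (α ε ε₀ A B : ℝ) :
    Prop where
  coeff : S.CoeffBound B
  data : s.DataSize N α ε₀ A
  boot : s.Bootstrap N T U α ε ε₀ A
  one_le_N : 1 ≤ N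
  A_pos : 0 < A
  Astar_pos : 0 < s.Astar
  eps_nonneg : 0 ≤ ε
  data_le_eps : ε₀ ≤ ε
  eps_le_alpha : ε ≤ α
  eps_le_one : ε ≤ 1
  alpha_le_one : α ≤ 1
  state_small : α + √ε ≤ 1
  xi_small : √α + √ε₀ ≤ 1 / 4
  th_small : 2 * d * √ε ≤ 1
  coeff_small : B * α ≤ 1 / 2
  U_pos : 0 < U
  U_le : U ≤ 1

namespace SmallSolution

theorem alpha_nonneg (h : s.SmallSolution N α ε ε₀ A B) : 0 ≤ α :=
  h.eps_nonneg.trans h.eps_le_alpha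

/-- On Σ₀ there is no loss of √ε: Ψ is bounded by the data and v by ε ≤ α̊. Hence μ - 1 is O(α̊)
there. -/
theorem state_initial_le (h : s.SmallSolution N α ε ε₀ A B) {q : Pt d} (hq : q ∈ slice 0 U) :
    ‖s.state (s.Υ q)‖ ≤ α := by
  have hs : q ∈ slice 0 1 := ⟨hq.1, hq.2.1, hq.2.2.trans h.U_le⟩
  have h1 := h.data.Ψ_small q hs
  refine max_le (show |s.Ψ (s.Υ q)| ≤ _ from h1)
    ((pi_norm_le_iff_of_nonneg h.alpha_nonneg).2 fun J => ?_)
  have h2 := h.boot.v_fund 0 ⟨le_rfl, h.boot.T_pos⟩ U ⟨h.U_pos.le, le_rfl⟩ J q hq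
  exact (s.abs_le_strSum (adm := AdmP) rfl (N - 1) (s.v J) _).trans
    ((le_abs_self _).trans (h2.trans h.eps_le_alpha))

theorem abs_mu_sub_le_interior (h : s.SmallSolution N α ε ε₀ A B) {p : Pt d} (h0 : 0 ≤ p 0)
    (hT : p 0 < T) (h1 : 0 < p 1) (hU : p 1 < U) :
    |s.mu (s.Υ p) - 1 - p 0 * s.blowupXbΨ (s.Υ p)| ≤
        2 * (B * α) + errorCoeff d B * ((1 + A) * (1 + s.Astar⁻¹)) ^ 3 * ε ∧
    |s.mu (s.Υ p) - 1 - p 0 * s.blowupXbΨ (s.Υ (Function.update p 0 0))| ≤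
        2 * (B * α) + errorCoeff d B * ((1 + A) * (1 + s.Astar⁻¹)) ^ 3 * ε := by
  have hA := h.A_pos
  have hAs := h.Astar_pos
  have hB := h.coeff.one_le
  have hε := h.eps_nonneg
  have hμ := h.boot.mu_pos
  have hb := fun q e1 e2 e3 e4 => pointwiseBounds_of_bootstrap (q := q) h.coeff h.data h.boot
    h.one_le_N hA hAs hε h.data_le_eps h.alpha_nonneg h.alpha_le_one h.eps_le_one h.state_small
    h.xi_small h.th_small h.U_le e1 e2 e3 e4
  have hTb : T ≤ 2 * s.Astar⁻¹ := h.boot.T_le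
  have k1 := abs_blowupXbΨ_sub_le h.eps_le_one hμ hb h0 hT h1 hU
  have k2 := abs_mu_sub_le h.eps_le_one hTb hμ hb h0 hT h1 hU
  have hi : |s.mu (s.Υ (Function.update p 0 0)) - 1| ≤ 2 * (B * α) := by
    have hs : Function.update p 0 0 ∈ slice 0 U :=
      ⟨by simp, by simpa using h1.le, by simpa using hU.le⟩
    rw [s.mu_initial h.boot.T_pos hs.1 (by simpa using h1) (by simpa using hU)]
    have hn := h.state_initial_le hs
    exact abs_one_div_sub_one_le ((h.coeff.abs_L_one_sub_le (hn.trans h.alpha_le_one)).trans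
      (by gcongr)) h.coeff_small
  set y := s.Astar⁻¹ with hy
  have hy0 : 0 < y := inv_pos.2 hAs
  -- Q dominates Å + 1, Å_*⁻¹ and their product up to constants. The drift is then linear in Q and
  -- the source quadratic; with times at most 2Q, every error is at most cubic.
  set Q := (1 + A) * (1 + y) with hQ
  have hQ1 : 1 ≤ Q := by nlinarith [mul_pos hA hy0]
  have ha : A + 1 ≤ Q := by nlinarith [mul_pos hA hy0]
  have hyQ : y ≤ Q := by nlinarith [mul_pos hA hy0]
  have hAy : A * y ≤ Q := by nlinarith [mul_pos hA hy0]
  have hm : 3 + 4 * B * A * y ≤ (3 + 4 * B) * Q := by nlinarith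
  have hm0 : 0 ≤ 3 + 4 * B * A * y := by positivity
  set D := driftBound d B (A + 1) (3 + 4 * B * A * y) with hD
  set Sr := sourceBound d B (A + 1) (3 + 4 * B * A * y) (2 * y) with hSr
  have hDle : D ≤ driftBound d B 1 (3 + 4 * B) * Q := driftBound_le hB ha hm
  have hSle : Sr ≤ sourceBound d B 1 (3 + 4 * B) 2 * Q ^ 2 :=
    sourceBound_le hB hQ1 ha hm (by linarith) (by linarith)
  set D1 := driftBound d B 1 (3 + 4 * B) with hD1
  set S1 := sourceBound d B 1 (3 + 4 * B) 2 with hS1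
  have htan : 0 ≤ tanBound d B := by unfold tanBound; positivity
  have hxi : 0 ≤ xiBound d B := by unfold xiBound; positivity
  have hD0 : 0 ≤ D := by rw [hD]; unfold driftBound; positivity
  have hD10 : 0 ≤ D1 := by rw [hD1]; unfold driftBound; positivity
  have hS10 : 0 ≤ S1 := by rw [hS1]; unfold sourceBound; positivity
  have hp2 : p 0 ≤ 2 * Q := by linarith
  have r1 : D * ε * p 0 ≤ 2 * D1 * Q ^ 2 * ε := by
    calc D * ε * p 0 ≤ (D1 * Q) * ε * (2 * Q) := by gcongr
      _ = _ := by ring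
  have r2 : (Sr + 2 * y * D) * ε * p 0 ≤ 2 * (S1 + 2 * D1) * Q ^ 3 * ε := by
    calc (Sr + 2 * y * D) * ε * p 0 ≤ (S1 * Q ^ 2 + 2 * Q * (D1 * Q)) * ε * (2 * Q) := by gcongr
      _ = _ := by ring
  have r1' : p 0 * (D * ε * p 0) ≤ 2 * Q * (2 * D1 * Q ^ 2 * ε) := by gcongr
  have hK : errorCoeff d B = 2 * (S1 + 2 * D1) + 4 * D1 + 1 := rfl
  have hQ3 : 0 ≤ Q ^ 3 * ε := by positivity
  have hDQ : 0 ≤ D1 * (Q ^ 3 * ε) := mul_nonneg hD10 hQ3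
  have e1 : |s.mu (s.Υ p) - 1 - p 0 * s.blowupXbΨ (s.Υ p)| ≤
      2 * (B * α) + 2 * (S1 + 2 * D1) * Q ^ 3 * ε := by
    have := abs_add_le (s.mu (s.Υ p) - p 0 * s.blowupXbΨ (s.Υ p)
      - s.mu (s.Υ (Function.update p 0 0))) (s.mu (s.Υ (Function.update p 0 0)) - 1)
    rw [show s.mu (s.Υ p) - 1 - p 0 * s.blowupXbΨ (s.Υ p) =
      (s.mu (s.Υ p) - p 0 * s.blowupXbΨ (s.Υ p) - s.mu (s.Υ (Function.update p 0 0)))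
        + (s.mu (s.Υ (Function.update p 0 0)) - 1) by ring]
    linarith
  have e2 : |p 0 * (s.blowupXbΨ (s.Υ p) - s.blowupXbΨ (s.Υ (Function.update p 0 0)))| ≤
      2 * Q * (2 * D1 * Q ^ 2 * ε) := by
    rw [abs_mul, abs_of_nonneg h0]
    exact (mul_le_mul_of_nonneg_left k1 h0).trans r1'
  refine ⟨e1.trans ?_, ?_⟩
  · rw [hK]; linarith
  · rw [show s.mu (s.Υ p) - 1 - p 0 * s.blowupXbΨ (s.Υ (Function.update p 0 0)) =
      (s.mu (s.Υ p) - 1 - p 0 * s.blowupXbΨ (s.Υ p))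
        + p 0 * (s.blowupXbΨ (s.Υ p) - s.blowupXbΨ (s.Υ (Function.update p 0 0))) by ring]
    refine (abs_add_le _ _).trans ((add_le_add e1 e2).trans ?_)
    rw [hK]; linarith

theorem continuousAt_mu_Υ (hμ : ∀ q ∈ geoRegion T U, 0 < s.mu (s.Υ q)) {p : Pt d}
    (hp : p ∈ geoRegion T U) : ContinuousAt (fun q => s.mu (s.Υ q)) p :=
  have hG : p ∈ geoRegion T U ∪ R := Or.inl hp
  ContinuousAt.comp (f := s.Υ) (s.contDiffAt_mu (mem_image_of_mem _ hG) (hμ p hp)).continuousAt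
    (s.smooth_Υ p hG).continuousAt

theorem continuousAt_blowupXbΨ_Υ (hμ : ∀ q ∈ geoRegion T U, 0 < s.mu (s.Υ q)) {p : Pt d}
    (hp : p ∈ geoRegion T U) : ContinuousAt (fun q => s.blowupXbΨ (s.Υ q)) p :=
  have hG : p ∈ geoRegion T U ∪ R := Or.inl hp
  ContinuousAt.comp (f := s.Υ)
    (differentiableAt_blowupXbΨ (mem_image_of_mem _ hG) (hμ p hp)).continuousAt
    (s.smooth_Υ p hG).continuousAt

theorem abs_mu_sub_le (h : s.SmallSolution N α ε ε₀ A B) {p : Pt d} (hp : p ∈ geoRegion T U) :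
    |s.mu (s.Υ p) - 1 - p 0 * s.blowupXbΨ (s.Υ p)| ≤
        2 * (B * α) + errorCoeff d B * ((1 + A) * (1 + s.Astar⁻¹)) ^ 3 * ε ∧
    |s.mu (s.Υ p) - 1 - p 0 * s.blowupXbΨ (s.Υ (Function.update p 0 0))| ≤
        2 * (B * α) + errorCoeff d B * ((1 + A) * (1 + s.Astar⁻¹)) ^ 3 * ε := by
  have hμ := h.boot.mu_pos
  have c0 : ContinuousAt (fun q : Pt d => q 0) p := (continuous_apply 0).continuousAt
  have c1 := continuousAt_mu_Υ hμ hp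
  have c2 := continuousAt_blowupXbΨ_Υ hμ hp
  have hp0 : Function.update p 0 0 ∈ geoRegion T U :=
    ⟨by simp, by simpa using h.boot.T_pos, by simpa using hp.2.2.1, by simpa using hp.2.2.2⟩
  have cu : ContinuousAt (fun q : Pt d => Function.update q 0 (0 : ℝ)) p :=
    (continuous_id.update 0 continuous_const).continuousAt
  have c3 : ContinuousAt (fun q => s.blowupXbΨ (s.Υ (Function.update q 0 0))) p :=
    ContinuousAt.comp (f := fun q : Pt d => Function.update q 0 (0 : ℝ))
      (continuousAt_blowupXbΨ_Υ hμ hp0) cu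
  exact ⟨le_of_forall_interior h.U_pos hp ((c1.sub continuousAt_const).sub (c0.mul c2)).abs
      fun q e1 e2 e3 e4 => (h.abs_mu_sub_le_interior e1 e2 e3 e4).1,
    le_of_forall_interior h.U_pos hp ((c1.sub continuousAt_const).sub (c0.mul c3)).abs
      fun q e1 e2 e3 e4 => (h.abs_mu_sub_le_interior e1 e2 e3 e4).2⟩

/-- Otherwise tÅ_* ≤ 2 gives t𝒢X̆Ψ ≥ -1/2, and the affine formula with error at most 1/4 yields μ ≥
1/4. -/
theorem blowupXbΨ_lt_of_mu_lt (h : s.SmallSolution N α ε ε₀ A B)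
    (hE : 2 * (B * α) + errorCoeff d B * ((1 + A) * (1 + s.Astar⁻¹)) ^ 3 * ε ≤ 1 / 4) {p : Pt d}
    (hp : p ∈ geoRegion T U) (hμ : s.mu (s.Υ p) < 1 / 4) :
    s.blowupXbΨ (s.Υ p) < -(1 / 4) * s.Astar := by
  by_contra! hcon
  have h1 := (abs_le.1 (h.abs_mu_sub_le hp).1).1
  have hAs := h.Astar_pos
  have ht : p 0 * s.Astar ≤ 2 := by
    have := hp.2.1.le.trans h.boot.T_le
    calc p 0 * s.Astar ≤ (2 * s.Astar⁻¹) * s.Astar := by gcongr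
      _ = 2 := by field_simp
  have h2 : p 0 * (-(1 / 4) * s.Astar) ≤ p 0 * s.blowupXbΨ (s.Υ p) :=
    mul_le_mul_of_nonneg_left hcon hp.1
  linarith

theorem abs_blowup_bounds (h : s.SmallSolution N α ε ε₀ A B) {r : ℝ}
    (hr : ∀ w, ‖w‖ < r → |S.dL1 w - S.dL1 0| < |S.dL1 0| / 4) (hαr : α + √ε < r) {p : Pt d}
    (hp : p ∈ geoRegion T U) :
    s.blowup (s.Υ p) ≠ 0 ∧ |s.blowup (s.Υ p)| ≤ 2 * |S.blowupBackground| := by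
  have h1 := hr _ ((state_norm_le h.boot h.eps_nonneg h.eps_le_one h.alpha_nonneg hp).trans_lt hαr)
  have h2 := (abs_xiSmall_le h.boot hp 0).trans h.xi_small
  have hc := abs_pos.2 S.dL1_zero_ne
  rw [S.blowupBackground_eq, abs_neg, blowup]
  simp only [xiSmall, if_true] at h2
  have h3 : |s.xi 0 (s.Υ p)| ≤ 5 / 4 := by
    rw [abs_le] at h2 ⊢
    constructor <;> linarith
  have h4 : |S.dL1 (s.state (s.Υ p))| ≤ 5 / 4 * |S.dL1 0| := by
    have := abs_sub_abs_le_abs_sub (S.dL1 (s.state (s.Υ p))) (S.dL1 0)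
    linarith
  refine ⟨mul_ne_zero (fun h0 => ?_) (fun h0 => ?_), ?_⟩
  · rw [h0, zero_sub, abs_neg] at h1
    linarith
  · rw [h0] at h2
    norm_num at h2
  · refine (PointwiseBounds.abs_mul_le h4 h3).trans ?_
    nlinarith

/-- Divide Å_*/4 < |𝒢| μ |XΨ| by μ and by the upper bound 2|g| for |𝒢|. -/
theorem lt_abs_opX_Ψ {p : Pt d} {g : ℝ} (hμ : 0 < s.mu (s.Υ p)) (hg : s.blowup (s.Υ p) ≠ 0)
    (hgb : |s.blowup (s.Υ p)| ≤ 2 * |g|)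
    (hH : s.blowupXbΨ (s.Υ p) < -(1 / 4) * s.Astar) :
    1 / (8 * |g|) * (1 / s.mu (s.Υ p)) * s.Astar < |s.opX s.Ψ (s.Υ p)| := by
  have hg0 : 0 < |g| := by have := abs_pos.2 hg; linarith
  have h1 : 1 / 4 * s.Astar < |s.blowupXbΨ (s.Υ p)| := by
    have := neg_le_abs (s.blowupXbΨ (s.Υ p))
    linarith
  have h2 : |s.blowupXbΨ (s.Υ p)| ≤ 2 * |g| * (s.mu (s.Υ p) * |s.opX s.Ψ (s.Υ p)|) := by
    refine PointwiseBounds.abs_mul_le hgb ?_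
    rw [opXb, abs_mul, abs_of_pos hμ]
  rw [show 1 / (8 * |g|) * (1 / s.mu (s.Υ p)) * s.Astar = s.Astar / (8 * |g| * s.mu (s.Υ p)) by
    field_simp, div_lt_iff₀ (by positivity)]
  linarith

end SmallSolution

/-! ### The minimum of μ over Σ_t -/

theorem mu_Υ_periodic (s : Solution S (geoRegion T U ∪ R)) (n : Fin d → ℤ) :
    Function.Periodic (fun p => s.mu (s.Υ p)) (∑ i, n i • basisVec (ang i)) := by
  have h1 : ∀ i, Function.Periodic (fun p => s.mu (s.Υ p)) (basisVec (ang i)) := by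
    intro i p
    have := pd_periodic (f := s.u) (a := basisVec (ang i)) (c := 0)
      (fun x => by rw [s.periodic_u, add_zero]) 0 (s.Υ p)
    simp only [s.periodic_Υ, mu, this]
  have h2 : ∀ F : Finset (Fin d),
      Function.Periodic (fun p => s.mu (s.Υ p)) (∑ i ∈ F, n i • basisVec (ang i)) := by
    classical
    intro F
    induction F using Finset.induction_on with
    | empty => intro p; simp
    | insert i F hi ih =>
      rw [Finset.sum_insert hi]
      exact ((h1 i).zsmul (n i)).add_period ih
  exact h2 _

/-- The lifted slice is not compact when torus directions are present. Integer translations move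
every point into the box with ϑ in [0,1]^d without changing μ, and on the box a minimum exists. -/
theorem exists_isLeast_mu_slice (hμ : ∀ q ∈ geoRegion T U, 0 < s.mu (s.Υ q)) (hU : 0 ≤ U) {t : ℝ}
    (ht : t ∈ Ico 0 T) : IsLeast ((fun p => s.mu (s.Υ p)) '' slice t U) (s.muStar t U) := by
  have hsub : ∀ p : Pt d, p ∈ slice t U → p ∈ geoRegion T U := fun p hp =>
    ⟨hp.1 ▸ ht.1, hp.1 ▸ ht.2, hp.2.1, hp.2.2⟩
  set lo : Pt d := Function.update 0 0 t with hlo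
  set hi : Pt d := Function.update (Function.update 1 1 U) 0 t with hhi
  have lo0 : lo 0 = t := Function.update_self _ _ _
  have lo1 : lo 1 = 0 := by simp [hlo]
  have loa : ∀ i, lo (ang i) = 0 := fun i => by simp [hlo, ang_ne_zero]
  have hi0 : hi 0 = t := Function.update_self _ _ _
  have hi1 : hi 1 = U := by simp [hhi]
  have hia : ∀ i, hi (ang i) = 1 := fun i => by simp [hhi, ang_ne_zero, ang_ne_one]
  have hIcc : ∀ p, p ∈ Icc lo hi ↔ p ∈ slice t U ∧ ∀ i, 0 ≤ p (ang i) ∧ p (ang i) ≤ 1 := by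
    intro p
    constructor
    · rintro ⟨h1, h2⟩
      have a0 := h1 0
      have b0 := h2 0
      have a1 := h1 1
      have b1 := h2 1
      rw [lo0] at a0
      rw [hi0] at b0
      rw [lo1] at a1
      rw [hi1] at b1
      exact ⟨⟨le_antisymm b0 a0, a1, b1⟩, fun i => ⟨loa i ▸ h1 (ang i), hia i ▸ h2 (ang i)⟩⟩
    · rintro ⟨h1, h2⟩
      refine ⟨fun α => ?_, fun α => ?_⟩
      · induction α using coord_cases with
        | h0 => rw [lo0, h1.1]
        | h1 => rw [lo1]; exact h1.2.1
        | h i => rw [loa]; exact (h2 i).1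
      · induction α using coord_cases with
        | h0 => rw [hi0, h1.1]
        | h1 => rw [hi1]; exact h1.2.2
        | h i => rw [hia]; exact (h2 i).2
  have hne : (Icc lo hi).Nonempty := ⟨lo, (hIcc lo).2 ⟨⟨lo0, lo1.ge, lo1 ▸ hU⟩, fun i => by
    rw [loa]; norm_num⟩⟩
  obtain ⟨p, hp, hmin⟩ := (isCompact_Icc (a := lo) (b := hi)).exists_isMinOn hne
    (fun q hq => (SmallSolution.continuousAt_mu_Υ hμ
      (hsub q ((hIcc q).1 hq).1)).continuousWithinAt)
  have hleast : IsLeast ((fun p => s.mu (s.Υ p)) '' slice t U) (s.mu (s.Υ p)) := by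
    refine ⟨mem_image_of_mem _ ((hIcc p).1 hp).1, ?_⟩
    rintro _ ⟨q, hq, rfl⟩
    set z : Pt d := ∑ i, (-⌊q (ang i)⌋ : ℤ) • basisVec (ang i) with hz
    have hz0 : z 0 = 0 := by simp [hz, Finset.sum_apply, basisVec, (ang_ne_zero _).symm]
    have hz1 : z 1 = 0 := by simp [hz, Finset.sum_apply, basisVec, (ang_ne_one _).symm]
    have hza : ∀ i, z (ang i) = -(⌊q (ang i)⌋ : ℝ) := fun i => by
      simp [hz, Finset.sum_apply, basisVec, Pi.single_apply, ang_injective.eq_iff]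
    have hper := s.mu_Υ_periodic (fun i => -⌊q (ang i)⌋) q
    rw [← hz] at hper
    refine (hmin ((hIcc (q + z)).2 ⟨⟨?_, ?_, ?_⟩, fun i => ?_⟩)).trans_eq hper
    · simpa [hz0] using hq.1
    · simpa [hz1] using hq.2.1
    · simpa [hz1] using hq.2.2
    · rw [Pi.add_apply, hza]
      have := Int.floor_le (q (ang i))
      have := Int.lt_floor_add_one (q (ang i))
      constructor <;> linarith
  rw [muStar, hleast.csInf_eq]
  exact hleast

/-- Below: at the minimizer, 𝒢X̆Ψ at the foot on Σ₀ is at least -Å_*. Above: a near-maximizer of the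
negative part on Σ₀ is carried along L to time t. -/
theorem SmallSolution.abs_muStar_sub_le {s : Solution S (geoRegion T 1 ∪ R)}
    (h : s.SmallSolution N α ε ε₀ A B) {t : ℝ} (ht : t ∈ Ico 0 T) :
    |s.muStar t 1 - (1 - t * s.Astar)| ≤
      2 * (B * α) + errorCoeff d B * ((1 + A) * (1 + s.Astar⁻¹)) ^ 3 * ε := by
  set E := 2 * (B * α) + errorCoeff d B * ((1 + A) * (1 + s.Astar⁻¹)) ^ 3 * ε with hE
  have hl := exists_isLeast_mu_slice h.boot.mu_pos zero_le_one ht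
  -- Needed because the real `sSup` bounds its set only if the set is bounded above.
  have hbdd : BddAbove ((fun p => |min (s.blowupXbΨ (s.Υ p)) 0|) '' slice 0 1) := by
    refine ⟨B * 2 * A, ?_⟩
    rintro _ ⟨q, hq, rfl⟩
    refine le_trans ?_ (abs_blowupXbΨ_initial_le h.coeff h.data h.boot h.eps_nonneg h.eps_le_one
      h.alpha_nonneg h.state_small h.xi_small le_rfl le_rfl hq)
    change |min (s.blowupXbΨ (s.Υ q)) 0| ≤ _
    rw [abs_of_nonpos (min_le_right (s.blowupXbΨ (s.Υ q)) 0), ← max_neg_neg, neg_zero]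
    exact max_le (neg_le_abs _) (abs_nonneg _)
  rw [abs_le]
  constructor
  · obtain ⟨p, hp, hpm⟩ := hl.1
    have hpG : p ∈ geoRegion T 1 := ⟨hp.1 ▸ ht.1, hp.1 ▸ ht.2, hp.2.1, hp.2.2⟩
    have h1 := (abs_le.1 (h.abs_mu_sub_le hpG).2).1
    have h2 : -s.Astar ≤ s.blowupXbΨ (s.Υ (Function.update p 0 0)) := by
      have := le_csSup hbdd (mem_image_of_mem _ (show Function.update p 0 0 ∈ slice 0 1 from
        ⟨by simp, by simpa using hp.2.1, by simpa using hp.2.2⟩))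
      have h3 := (neg_le_abs _).trans this
      have h4 := min_le_left (s.blowupXbΨ (s.Υ (Function.update p 0 0))) 0
      change _ ≤ s.Astar at h3
      linarith
    rw [hp.1] at h1
    have h3 := mul_le_mul_of_nonneg_left h2 ht.1
    simp only at hpm
    rw [← hpm]
    linarith
  -- The supremum need not be attained, so each c below Å_* is used and then c tends to Å_*.
  -- Positivity of c excludes the case in which the minimum with 0 equals 0.
  · have hc : ∀ c ∈ Ioo 0 s.Astar, s.muStar t 1 ≤ 1 - t * c + E := by
      intro c hc
      obtain ⟨_, ⟨q, hq, rfl⟩, hcq⟩ := exists_lt_of_lt_csSup (image_nonempty.2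
        (⟨0, rfl, le_rfl, zero_le_one⟩ : (slice 0 1 : Set (Pt d)).Nonempty)) hc.2
      have h2 : s.blowupXbΨ (s.Υ q) ≤ -c := by
        change c < |min (s.blowupXbΨ (s.Υ q)) 0| at hcq
        rw [abs_of_nonpos (min_le_right (s.blowupXbΨ (s.Υ q)) 0)] at hcq
        rcases min_choice (s.blowupXbΨ (s.Υ q)) 0 with h3 | h3 <;> rw [h3] at hcq
        · linarith
        · linarith [hc.1]
      have e0 : Function.update (Function.update q 0 t) 0 0 = q := by
        rw [Function.update_idem, ← hq.1, Function.update_eq_self]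
      have hs : Function.update q 0 t ∈ slice t 1 :=
        ⟨by simp, by simpa using hq.2.1, by simpa using hq.2.2⟩
      have h1 := (abs_le.1 (h.abs_mu_sub_le (p := Function.update q 0 t)
        ⟨by simpa using ht.1, by simpa using ht.2, hs.2.1, hs.2.2⟩).2).2
      rw [e0, Function.update_self] at h1
      have h3 := mul_le_mul_of_nonneg_left h2 ht.1
      have h4 := hl.2 (mem_image_of_mem _ hs)
      linarith
    have hlim : Tendsto (fun c => 1 - t * c + E) (𝓝[<] s.Astar) (𝓝 (1 - t * s.Astar + E)) :=
      Tendsto.mono_left (Continuous.tendsto (by fun_prop) _) nhdsWithin_le_nhds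
    have := ge_of_tendsto hlim (eventually_of_mem (Ioo_mem_nhdsLT h.Astar_pos) hc)
    linarith

end Solution

/-! ### Smallness thresholds and choice of constants -/

/-- The threshold `b ↦ c (b / (1 + b))⁶`; note `A⁻¹ / (1 + A⁻¹) = (1 + A)⁻¹`. -/
noncomputable def smallnessFun (c b : ℝ) : ℝ := c * (b / (1 + b)) ^ 6

theorem isSmallnessFun_smallnessFun {c : ℝ} (hc : 0 < c) : IsSmallnessFun (smallnessFun c) := by
  refine ⟨?_, ?_, fun b hb => by unfold smallnessFun; positivity⟩
  · refine continuousOn_const.mul (ContinuousOn.pow (continuousOn_id.div (by fun_prop) ?_) 6)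
    intro b hb
    have : (0 : ℝ) < b := hb
    positivity
  · intro b hb b' hb' hlt
    have h1 : (0 : ℝ) < b := hb
    have h2 : (0 : ℝ) < b' := hb'
    unfold smallnessFun
    have : b / (1 + b) < b' / (1 + b') := by
      rw [div_lt_div_iff₀ (by positivity) (by positivity)]
      nlinarith
    gcongr

/-- The two separate conditions are multiplied: ε(1 + A)⁶ and ε(1 + y⁻¹)⁶ are both below c, and the
square root of their product is the quantity in question. This is why the thresholds carry the sixth
power. -/
theorem mul_cube_le_of_lt_smallnessFun {c ε A y : ℝ} (hc : 0 < c) (hε : 0 ≤ ε) (hA : 0 < A)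
    (hy : 0 < y) (h1 : ε < smallnessFun c A⁻¹) (h2 : ε < smallnessFun c y) :
    ((1 + A) * (1 + y⁻¹)) ^ 3 * ε ≤ c := by
  have e1 : A⁻¹ / (1 + A⁻¹) = (1 + A)⁻¹ := by field_simp; ring
  have e2 : y / (1 + y) = (1 + y⁻¹)⁻¹ := by field_simp; ring
  rw [smallnessFun, e1, inv_pow, ← div_eq_mul_inv, lt_div_iff₀ (by positivity)] at h1
  rw [smallnessFun, e2, inv_pow, ← div_eq_mul_inv, lt_div_iff₀ (by positivity)] at h2
  refine (abs_le_of_sq_le_sq' ?_ hc.le).2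
  calc (((1 + A) * (1 + y⁻¹)) ^ 3 * ε) ^ 2 = (ε * (1 + A) ^ 6) * (ε * (1 + y⁻¹) ^ 6) := by ring
    _ ≤ c * c := by gcongr
    _ = c ^ 2 := by ring

end ShockTransport

open ShockTransport ShockTransport.Solution in
theorem lemma6p5 (d M Ntop : ℕ) (hM : 1 ≤ M) (hN : (d + 1) + 5 ≤ Ntop)
    (S : ShockTransport.System d M) :
    -- constants and smallness thresholds depend only on the system, `n = d + 1`, `M`, `Ntop`
    ∃ (Cstar δ : ℝ) (C : ℝ × ℝ → ℝ) (f g : ℝ → ℝ),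
      0 < Cstar ∧ 0 < δ ∧ Continuous C ∧ Monotone C ∧ (∀ z, 0 < C z) ∧
      ShockTransport.IsSmallnessFun f ∧ ShockTransport.IsSmallnessFun g ∧
      ∀ (U₀ T τ α ε ε₀ A : ℝ)
        (s : ShockTransport.Solution S
          (ShockTransport.geoRegion T U₀ ∪ ShockTransport.geoRegion τ 1)),
        0 < U₀ → U₀ ≤ 1 → 0 < τ →
        0 < A → 0 < s.Astar →
        s.DataSize (ShockTransport.Nmid Ntop) α ε₀ A →
        s.Bootstrap (ShockTransport.Nmid Ntop) T U₀ α ε ε₀ A →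
        α < δ → 0 < ε → ε < δ → ε < f A⁻¹ → ε < g s.Astar → 0 ≤ ε₀ → ε₀ ≤ ε → ε < α →
        -- the blowup-coefficient does not vanish
        (S.blowupBackground ≠ 0 ∧
          ∀ p ∈ ShockTransport.geoRegion T U₀, s.blowup (s.Υ p) ≠ 0) ∧
        (∀ p ∈ ShockTransport.geoRegion T U₀, s.mu (s.Υ p) < 1 / 4 →
          s.blowup (s.Υ p) * s.opXb s.Ψ (s.Υ p) < -(1 / 4) * s.Astar) ∧
        (∀ p ∈ ShockTransport.geoRegion T U₀, s.mu (s.Υ p) < 1 / 4 →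
          |s.opX s.Ψ (s.Υ p)| >
            1 / (8 * |S.blowupBackground|) * (1 / s.mu (s.Υ p)) * s.Astar) ∧
        (U₀ = 1 → ∀ t ∈ Set.Ico 0 T,
          -- the minimum is attained
          IsLeast ((fun p => s.mu (s.Υ p)) '' ShockTransport.slice t 1) (s.muStar t 1) ∧
          |s.muStar t 1 - (1 - t * s.Astar)| ≤ Cstar * α + C (A, s.Astar⁻¹) * ε) ∧
        -- if the minimum tends to zero at time `T`, then `T` is close to `1 / Astar`
        (U₀ = 1 → Filter.Tendsto (fun t => s.muStar t 1) (nhdsWithin T (Set.Iio T)) (nhds 0) →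
          |1 - T * s.Astar| ≤ Cstar * α + C (A, s.Astar⁻¹) * ε) := by
  obtain ⟨B, hB⟩ := S.exists_coeffBound
  obtain ⟨r, hr, hr1, hrad⟩ := S.exists_radius
  have hB1 := hB.one_le
  have hKpos := errorCoeff_pos (d := d) hB1
  set K := errorCoeff d B with hK
  -- κ will bound √α̊, √ε and √ε̊. The four entries ensure, in order, √α̊ + √ε̊ ≤ 1/4, states within
  -- radius r, absorption in the ϑ-system, and an error 2Bα̊ ≤ 1/8.
  set κ : ℝ := min (min (1 / 8) (r / 4)) (min (1 / (2 * (d + 1))) (1 / (16 * B))) with hκ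
  have hκ0 : 0 < κ := by rw [hκ]; positivity
  have hκ8 : κ ≤ 1 / 8 := (min_le_left _ _).trans (min_le_left _ _)
  have hκr : κ ≤ r / 4 := (min_le_left _ _).trans (min_le_right _ _)
  have hκd : 2 * d * κ ≤ 1 := by
    have h1 : κ ≤ 1 / (2 * (d + 1)) := (min_le_right _ _).trans (min_le_left _ _)
    rw [le_div_iff₀ (by positivity)] at h1
    linarith
  have hκB : B * κ ≤ 1 / 16 := by
    have h1 : κ ≤ 1 / (16 * B) := (min_le_right _ _).trans (min_le_right _ _)
    rw [le_div_iff₀ (by positivity)] at h1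
    linarith
  have hf := isSmallnessFun_smallnessFun (c := 1 / (8 * K)) (by positivity)
  -- The truncations at 0 make C positive and monotone on the whole plane; at (Å, Å_*⁻¹) they have
  -- no effect. The thresholds leave 1/8 for the ε-error, so the total error is at most 1/4.
  refine ⟨2 * B, κ ^ 2, fun z => K * ((1 + max z.1 0) * (1 + max z.2 0)) ^ 3,
    smallnessFun (1 / (8 * K)), smallnessFun (1 / (8 * K)), by positivity, by positivity,
    by fun_prop, ?_, fun z => by positivity, hf, hf, ?_⟩
  · intro z z' hz
    have h1 := hz.1
    have h2 := hz.2
    dsimp only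
    gcongr
  intro U₀ T τ α ε ε₀ A s hU₀ hU₁ _ hA hAs hds hbs hαδ hε0 hεδ hεf hεg hε₀ hεε hεα
  have hsα : √α < κ := (Real.sqrt_lt' hκ0).2 hαδ
  have hsε : √ε < κ := (Real.sqrt_lt' hκ0).2 hεδ
  have hsε₀ : √ε₀ < κ := (Real.sqrt_le_sqrt hεε).trans_lt hsε
  have hακ : α ≤ κ := by nlinarith
  have hsmall : s.SmallSolution (Nmid Ntop) α ε ε₀ A B :=
    { coeff := hB
      data := hds
      boot := hbs
      one_le_N := Nat.le_add_left _ _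
      A_pos := hA
      Astar_pos := hAs
      eps_nonneg := hε0.le
      data_le_eps := hεε
      eps_le_alpha := hεα.le
      eps_le_one := by linarith
      alpha_le_one := by linarith
      state_small := by linarith
      xi_small := by linarith
      th_small := (mul_le_mul_of_nonneg_left hsε.le (by positivity)).trans hκd
      coeff_small := by nlinarith
      U_pos := hU₀
      U_le := hU₁ }
  have herr : K * ((1 + A) * (1 + s.Astar⁻¹)) ^ 3 * ε ≤ 1 / 8 := by
    have h1 := mul_cube_le_of_lt_smallnessFun (by positivity) hε0.le hA hAs hεf hεg
    calc _ = K * (((1 + A) * (1 + s.Astar⁻¹)) ^ 3 * ε) := by ring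
      _ ≤ K * (1 / (8 * K)) := by gcongr
      _ = 1 / 8 := by field_simp
  have hE : 2 * (B * α) + K * ((1 + A) * (1 + s.Astar⁻¹)) ^ 3 * ε ≤ 1 / 4 := by nlinarith
  have hG := fun p hp => hsmall.abs_blowup_bounds hrad (by linarith) (p := p) hp
  have hH := fun p hp hμ => hsmall.blowupXbΨ_lt_of_mu_lt hE (p := p) hp hμ
  have hC : 2 * B * α + K * ((1 + max A 0) * (1 + max s.Astar⁻¹ 0)) ^ 3 * ε =
      2 * (B * α) + K * ((1 + A) * (1 + s.Astar⁻¹)) ^ 3 * ε := by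
    rw [max_eq_left hA.le, max_eq_left (inv_pos.2 hAs).le]
    ring
  refine ⟨⟨?_, fun p hp => (hG p hp).1⟩, hH, fun p hp hμ =>
    SmallSolution.lt_abs_opX_Ψ (hbs.mu_pos p hp) (hG p hp).1 (hG p hp).2 (hH p hp hμ), ?_, ?_⟩
  · rw [S.blowupBackground_eq]
    exact neg_ne_zero.2 S.dL1_zero_ne
  · rintro rfl t ht
    refine ⟨exists_isLeast_mu_slice hbs.mu_pos zero_le_one ht, ?_⟩
    dsimp only
    rw [hC]
    exact hsmall.abs_muStar_sub_le ht
  · rintro rfl hlim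
    dsimp only
    rw [hC, ← abs_neg, ← zero_sub]
    have h1 : Tendsto (fun t => 1 - t * s.Astar) (𝓝[<] T) (𝓝 (1 - T * s.Astar)) :=
      Tendsto.mono_left (Continuous.tendsto (by fun_prop) _) nhdsWithin_le_nhds
    -- The estimate for the minimum holds with a bound independent of t, so it passes to the limit t
    -- ↑ T.
    refine le_of_tendsto (hlim.sub h1).abs ?_
    filter_upwards [Ioo_mem_nhdsLT hbs.T_pos] with t ht
    exact hsmall.abs_muStar_sub_le ⟨ht.1.le, ht.2⟩
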